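/- **Setting.** Full data are $(M^*,A,X,U,V)$ with $M^*\in\mathcal M\subseteq E$ ($E$ a real vector space with a standard Borel structure), an annotation indicator $A\in\{0,1\}$, and $X,U,V$ taking values in standard Borel spaces. Observed data are $W=(M,A,X,U,V)$ with $M=A\,M^*$. Fix a measurable $g:E\times\mathcal V\to\mathbb R$ that is homogeneous of degree one in its first argument, and a measurable $\pi:\mathcal X\to[\eta,1]$ with $\eta>0$. Put $\tilde M^*=g(M^*,V)$, $\tilde M=g(M,V)$ and $\tilde X=(X,U,V)$. **Model.** $\mathcal P_\pi$ is the set of laws of $W$ induced by all laws of the full data for which $M^*\in\mathcal M$ a.s., $(U,M^*)\perp A\mid X$ (missing at random), $V\perp A\mid (X,U,M^*)$, $P(A=1\mid X)=\pi(X)$ a.s. (known annotation score), and $E[(\tilde M^*)^2]<\infty$. For $P\in\mathcal P_\pi$ let $\tilde\mu_P(\tilde X)=E_P[\tilde M\mid A=1,\tilde X]$ and $\theta(P)=E_P[\tilde\mu_P(\tilde X)]$ (the MAR-S mean functional). **Efficient influence function.** Fix $P\in\mathcal P_\pi$. Consider all paths $t\mapsto P_t\in\mathcal P_\pi$, $0\le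 t<\varepsilon$, with $P_0=P$ and $\sup_{0\le t<\varepsilon}E_{P_t}[\tilde M^2]<\infty$, that are differentiable in quadratic mean at $t=0$, with score $h\in L^2(P)$: $$\int\Big(\frac{\sqrt{dP_t}-\sqrt{dP}}{t}-\tfrac12 h\sqrt{dP}\Big)^2\longrightarrow 0\qquad(t\downarrow0).$$ The tangent space at $P$ is the closed linear span in $L^2(P)$ of all such scores. A function $\varphi\in L^2(P)$ is an efficient influence function of $\theta$ at $P$ if $\lim_{t\downarrow0}(\theta(P_t)-\theta(P))/t=E_P[\varphi h]$ for every such path with score $h$, and $\varphi$ lies in the tangent space. **Proposition.** For every $P\in\mathcal P_\pi$ the functional $\theta$ has an efficient influence function at $P$ relative to $\mathcal P_\pi$; it is unique up to $P$-null sets and equals $$\varphi(W)=\tilde\mu_P(\tilde X)+\frac{A}{\pi(X)}\bigl(\tilde M-\tilde\mu_P(\tilde X)\bigr)-\theta(P).$$ -/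

import Mathlib

open MeasureTheory ProbabilityTheory Filter Topology
open scoped ENNReal NNReal

noncomputable section

/-! Semiparametric efficiency for a general model: differentiable one-dimensional submodels,
pathwise differentiability and the efficient influence function. -/

namespace Semiparametric

variable {W : Type*} [MeasurableSpace W]

/-- The squared `L²`-norm of `(√dR - √dP) / t - (1/2) h √dP`, computed with the densities of `P`
and `R` relative to the dominating measure `P + R` (its value does not depend on the choice of the
dominating measure). -/
def qmdResidual (P R : Measure W) (h : W → ℝ) (t : ℝ) : ℝ≥0∞ :=
  ∫⁻ w, ENNReal.ofReal
    (((√((R.rnDeriv (P + R) w).toReal) - √((P.rnDeriv (P + R) w).toReal)) / t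
      - 1 / 2 * h w * √((P.rnDeriv (P + R) w).toReal)) ^ 2) ∂(P + R)

/-- The path `t ↦ γ t`, `t ≥ 0`, is differentiable in quadratic mean at `P` as `t ↓ 0`, with score
function `h ∈ L²(P)`. -/
def HasScore (P : Measure W) (γ : ℝ → Measure W) (h : W → ℝ) : Prop :=
  MemLp h 2 P ∧ Tendsto (fun t : ℝ => qmdResidual P (γ t) h t) (𝓝[>] 0) (𝓝 0)

/-- The tangent set at `P` of a collection of paths: all their scores, as elements of `L²(P)`. -/
def tangentSet (P : Measure W) (paths : Set (ℝ → Measure W)) : Set (Lp ℝ 2 P) :=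
  {s | ∃ γ ∈ paths, HasScore P γ s}

/-- The tangent space: the closed linear span of the tangent set in `L²(P)`. -/
def tangentSpace (P : Measure W) (paths : Set (ℝ → Measure W)) : Submodule ℝ (Lp ℝ 2 P) :=
  (Submodule.span ℝ (tangentSet P paths)).topologicalClosure

/-- `φ ∈ L²(P)` is an influence function (a gradient) of `θ` at `P`: along every path of the
collection that is differentiable in quadratic mean, with score `h`, the functional `θ` has the
derivative `E_P[φ h]` at `t = 0`. -/
def IsInfluenceFunction (P : Measure W) (paths : Set (ℝ → Measure W)) (θ : Measure W → ℝ)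
    (φ : W → ℝ) : Prop :=
  MemLp φ 2 P ∧ ∀ γ ∈ paths, ∀ h : W → ℝ, HasScore P γ h →
    Tendsto (fun t : ℝ => (θ (γ t) - θ P) / t) (𝓝[>] 0) (𝓝 (∫ w, φ w * h w ∂P))

/-- `φ` is an efficient influence function (canonical gradient) of `θ` at `P`: an influence
function that lies in the tangent space. -/
def IsEfficientInfluenceFunction (P : Measure W) (paths : Set (ℝ → Measure W))
    (θ : Measure W → ℝ) (φ : W → ℝ) : Prop :=
  IsInfluenceFunction P paths θ φ ∧
    ∃ hφ : MemLp φ 2 P, hφ.toLp φ ∈ tangentSpace P paths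

end Semiparametric

/-! Missing-at-random structured data. -/

namespace MARS

/-- A data point: structured data, annotation indicator, covariates `X`, unstructured data `U` and
context variables `V`. It serves both for the full data `(M*, A, X, U, V)` and for the observed
data `W = (M, A, X, U, V)`. -/
abbrev Data (E 𝓧 𝓤 𝓥 : Type*) := E × Bool × 𝓧 × 𝓤 × 𝓥

variable {E 𝓧 𝓤 𝓥 : Type*}

/-- The structured-data coordinate: `M*` for full data, `M` for observed data. -/
def structured (w : Data E 𝓧 𝓤 𝓥) : E := w.1

def annotated (w : Data E 𝓧 𝓤 𝓥) : Bool := w.2.1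

/-- The annotation indicator `A` as a number in `{0, 1}`. -/
def annot (w : Data E 𝓧 𝓤 𝓥) : ℝ := if annotated w then 1 else 0

def covX (w : Data E 𝓧 𝓤 𝓥) : 𝓧 := w.2.2.1

def unstr (w : Data E 𝓧 𝓤 𝓥) : 𝓤 := w.2.2.2.1

def ctx (w : Data E 𝓧 𝓤 𝓥) : 𝓥 := w.2.2.2.2

/-- `X̃ = (X, U, V)`. -/
def features (w : Data E 𝓧 𝓤 𝓥) : 𝓧 × 𝓤 × 𝓥 := (covX w, unstr w, ctx w)

/-- `g(M*, V)` for full data, `M̃ = g(M, V)` for observed data. -/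
def transformed (g : E → 𝓥 → ℝ) (w : Data E 𝓧 𝓤 𝓥) : ℝ := g (structured w) (ctx w)

/-- From full to observed data: `M = A M*`, the other coordinates being observed as they are. -/
def observe [AddCommGroup E] [Module ℝ E] (w : Data E 𝓧 𝓤 𝓥) : Data E 𝓧 𝓤 𝓥 :=
  (annot w • structured w, annotated w, covX w, unstr w, ctx w)

variable [MeasurableSpace E] [MeasurableSpace 𝓧] [MeasurableSpace 𝓤] [MeasurableSpace 𝓥]

theorem measurable_covX : Measurable (covX : Data E 𝓧 𝓤 𝓥 → 𝓧) := by
  unfold covX; fun_prop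

theorem measurable_covX_unstr_structured :
    Measurable (fun w : Data E 𝓧 𝓤 𝓥 => (covX w, unstr w, structured w)) := by
  unfold covX unstr structured; fun_prop

/-- Laws `Q` of the full data `(M*, A, X, U, V)` with annotation score `π`. -/
structure IsFullDataLaw [StandardBorelSpace E] [StandardBorelSpace 𝓧] [StandardBorelSpace 𝓤]
    [StandardBorelSpace 𝓥] (𝓜 : Set E) (g : E → 𝓥 → ℝ) (π : 𝓧 → ℝ)
    (Q : Measure (Data E 𝓧 𝓤 𝓥)) [IsProbabilityMeasure Q] : Prop where
  /-- `M*` takes its values in `𝓜`. -/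
  mem_range : ∀ᵐ w ∂Q, structured w ∈ 𝓜
  /-- Missing at random: `(U, M*)` and `A` are independent given `X`. -/
  mar : CondIndepFun (MeasurableSpace.comap covX inferInstance) measurable_covX.comap_le
    (fun w => (unstr w, structured w)) annotated Q
  /-- `V` and `A` are independent given `(X, U, M*)`. -/
  ctx_indep : CondIndepFun
    (MeasurableSpace.comap (fun w => (covX w, unstr w, structured w)) inferInstance)
    measurable_covX_unstr_structured.comap_le ctx annotated Q
  /-- Known annotation score: `Q(A = 1 | X) = π(X)`. -/
  score : Q[annot | MeasurableSpace.comap covX inferInstance] =ᵐ[Q] fun w => π (covX w)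
  /-- `g(M*, V)` has a finite second moment. -/
  memLp : MemLp (transformed g) 2 Q

/-- The semiparametric model `𝒫_π` with known annotation score `π`: the laws of the observed data
`W = (A M*, A, X, U, V)`. -/
def model [AddCommGroup E] [Module ℝ E] [StandardBorelSpace E] [StandardBorelSpace 𝓧]
    [StandardBorelSpace 𝓤] [StandardBorelSpace 𝓥] (𝓜 : Set E) (g : E → 𝓥 → ℝ) (π : 𝓧 → ℝ) :
    Set (Measure (Data E 𝓧 𝓤 𝓥)) :=
  {P | ∃ (Q : Measure (Data E 𝓧 𝓤 𝓥)) (_ : IsProbabilityMeasure Q),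
    IsFullDataLaw 𝓜 g π Q ∧ P = Q.map observe}

/-- Paths `t ↦ γ t` in the model that start at `P` and along which the second moment of `M̃` stays
bounded near `t = 0`. -/
def paths [AddCommGroup E] [Module ℝ E] [StandardBorelSpace E] [StandardBorelSpace 𝓧]
    [StandardBorelSpace 𝓤] [StandardBorelSpace 𝓥] (𝓜 : Set E) (g : E → 𝓥 → ℝ) (π : 𝓧 → ℝ)
    (P : Measure (Data E 𝓧 𝓤 𝓥)) : Set (ℝ → Measure (Data E 𝓧 𝓤 𝓥)) :=
  {γ | γ 0 = P ∧ ∃ ε > 0, ∃ C : ℝ≥0, ∀ t ∈ Set.Ico 0 ε,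
    γ t ∈ model 𝓜 g π ∧ ∫⁻ w, ENNReal.ofReal (transformed g w ^ 2) ∂(γ t) ≤ C}

/-- The random variable `μ̃(X̃) = E_P[M̃ | A = 1, X̃]`. -/
def imputation (g : E → 𝓥 → ℝ) (P : Measure (Data E 𝓧 𝓤 𝓥)) : Data E 𝓧 𝓤 𝓥 → ℝ :=
  condExp (MeasurableSpace.comap features inferInstance) (cond P {w | annotated w = true})
    (transformed g)

/-- The functional `θ(P) = E_P[μ̃(X̃)]`. -/
def meanFunctional (g : E → 𝓥 → ℝ) (P : Measure (Data E 𝓧 𝓤 𝓥)) : ℝ :=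
  ∫ w, imputation g P w ∂P

/-- `μ̃(X̃) + A / π(X) * (M̃ - μ̃(X̃)) - θ(P)`. -/
def aipw (g : E → 𝓥 → ℝ) (π : 𝓧 → ℝ) (P : Measure (Data E 𝓧 𝓤 𝓥)) (w : Data E 𝓧 𝓤 𝓥) : ℝ :=
  imputation g P w + annot w / π (covX w) * (transformed g w - imputation g P w)
    - meanFunctional g P

end MARS

end

/-! ### Differentiability in quadratic mean and uniqueness of the efficient influence function. -/

noncomputable section

namespace Semiparametric

variable {W : Type*} [MeasurableSpace W]

/-! Two efficient influence functions have the same inner product with every score, so their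
difference lies in the tangent space and is orthogonal to it, hence is zero. It remains to show that
the AIPW function is a gradient and lies in the tangent space.

Gradient. Throughout the model `E[A | X̃] = π(X)` with the same `π`, so weighting by `A / π` leaves
integrals of functions of `X̃` unchanged. This gives `θ(P) = E_P[M̃ / π(X)]`
(`IsObservedLaw.meanFunctional_eq`): on the model `θ` is linear in `P`. A linear functional `∫ ψ dP`
with second moments bounded along the path has derivative `E_P[ψ h]` (`HasScore.tendsto_integral`).
Finally `M̃ / π` may be replaced by the AIPW function, because their difference has the form `F (A /
π - 1) + c` with `F` a function of `X̃`. For bounded `F` this has expectation `c` under every law of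
the model and is therefore orthogonal to all scores; truncation covers square-integrable `F`
(`integral_weight_mul_score`).

Tangent space. A full-data law `Q` in the model is characterised, besides range and moment, by `E[A
| X, U, M*, V] = π(X)`. This survives reweighting by `1 + t H` for bounded centred `H(X, U, M*, V)`,
and the image in the observed data has the score `E_Q[H | W]` (`exists_path_of_bounded`). The AIPW
function is itself of this form, with `H = μ̃ - θ + (g(M*, V) - μ̃) / π` (`condExp_fullDataScore`):
on `A = 1` the two agree, and on `A = 0` the residual averages out because `M*` and `A` are
independent given `X̃`. This `H` need not be bounded, but it is an `L²`-limit of simple functions,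
and conditional expectation is an `L²`-contraction (`aipw_mem_tangentSpace`). -/

theorem qmdResidual_congr {P : Measure W} [IsFiniteMeasure P] {R : Measure W} [IsFiniteMeasure R]
    {h h' : W → ℝ} (hh : h =ᵐ[P] h') (t : ℝ) : qmdResidual P R h t = qmdResidual P R h' t := by
  have hac : P ≪ P + R := Measure.absolutelyContinuous_of_le (Measure.le_add_right le_rfl)
  rw [← Measure.withDensity_rnDeriv_eq P (P + R) hac] at hh
  have h1 := (ae_withDensity_iff (Measure.measurable_rnDeriv P (P + R))).1 hh
  refine lintegral_congr_ae ?_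
  filter_upwards [h1] with w hw
  -- `h` and `h'` may differ on a set charged by `R`, but there the density of `P` vanishes and
  -- kills the score term.
  by_cases h0 : P.rnDeriv (P + R) w = 0
  · simp [h0]
  · rw [hw h0]

theorem HasScore.congr {P : Measure W} [IsFiniteMeasure P] {γ : ℝ → Measure W} {h h' : W → ℝ}
    (hγ : ∀ᶠ t in 𝓝[>] (0 : ℝ), IsFiniteMeasure (γ t)) (hh : h =ᵐ[P] h')
    (hs : HasScore P γ h) : HasScore P γ h' := by
  refine ⟨hs.1.ae_eq hh, hs.2.congr' ?_⟩
  filter_upwards [hγ] with t ht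
  exact qmdResidual_congr hh t

/-- Here `a = √p`, `b = √r`, and `u` is the residual. Since `b² - a² = (b - a)(a + b)`, the left
side is `u ψ (a + b) + ½ h a ψ (b - a)`. Young's inequality with parameter `δ` treats the first
term. In the second, `b - a` is of order `t` where `|ψ| ≤ K`; where `|ψ| > K` the tail of `h²` is
paid for instead. No bound on `ψ` is needed. -/
theorem abs_qmd_difference_le {a b ψ h t δ K : ℝ} (ht : 0 < t) (hδ : 0 < δ) :
    |b ^ 2 * (ψ / t) - a ^ 2 * (ψ / t) - a ^ 2 * (ψ * h)| ≤
      (1 / (2 * δ) + K ^ 2 * t ^ 2 / (2 * δ)) * ((b - a) / t - 1 / 2 * h * a) ^ 2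
        + 3 / 2 * δ * (a ^ 2 * ψ ^ 2 + b ^ 2 * ψ ^ 2)
        + (δ / 4 + K ^ 2 * t ^ 2 / (8 * δ)) * (a ^ 2 * h ^ 2)
        + 1 / (4 * δ) * (a ^ 2 * (if K < |ψ| then h ^ 2 else 0)) := by
  obtain ⟨u, hu⟩ : ∃ u, u = (b - a) / t - 1 / 2 * h * a := ⟨_, rfl⟩
  have hb : b - a = t * (u + 1 / 2 * h * a) := by rw [hu]; field_simp; ring
  have hE : b ^ 2 * (ψ / t) - a ^ 2 * (ψ / t) - a ^ 2 * (ψ * h)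
      = u * (ψ * (a + b)) + (1 / 2) * ((h * a) * (ψ * (b - a))) := by
    rw [hu]; field_simp; ring
  rw [hE, ← hu]
  have young : ∀ x y : ℝ, |x * y| ≤ x ^ 2 / (2 * δ) + δ / 2 * y ^ 2 := by
    intro x y
    have h1 : 0 ≤ (|x| - δ * |y|) ^ 2 / (2 * δ) := by positivity
    have h2 : (|x| - δ * |y|) ^ 2 / (2 * δ) = |x| ^ 2 / (2 * δ) + δ / 2 * |y| ^ 2 - |x| * |y| := by
      field_simp; ring
    rw [abs_mul, ← sq_abs x, ← sq_abs y]; linarith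
  have h1 := young u (ψ * (a + b))
  have h1' : (ψ * (a + b)) ^ 2 ≤ 2 * (a ^ 2 * ψ ^ 2 + b ^ 2 * ψ ^ 2) := by
    nlinarith [mul_nonneg (sq_nonneg ψ) (sq_nonneg (a - b))]
  have h2 : |(1 / 2) * ((h * a) * (ψ * (b - a)))| ≤
      K ^ 2 * t ^ 2 / (2 * δ) * u ^ 2 + 1 / 2 * δ * (a ^ 2 * ψ ^ 2 + b ^ 2 * ψ ^ 2)
       + (δ / 4 + K ^ 2 * t ^ 2 / (8 * δ)) * (a ^ 2 * h ^ 2)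
       + 1 / (4 * δ) * (a ^ 2 * (if K < |ψ| then h ^ 2 else 0)) := by
    rw [abs_mul, abs_of_pos (by norm_num : (0 : ℝ) < 1 / 2)]
    -- The two cases put the large weight `1 / (2δ)` on opposite factors: on `h a` in the tail, on
    -- `ψ (b - a)` elsewhere.
    split_ifs with hK
    · have h3 := young (h * a) (ψ * (b - a))
      have h4 : (ψ * (b - a)) ^ 2 ≤ 2 * (a ^ 2 * ψ ^ 2 + b ^ 2 * ψ ^ 2) := by
        nlinarith [mul_nonneg (sq_nonneg ψ) (sq_nonneg (a + b))]
      have h5 : 0 ≤ K ^ 2 * t ^ 2 / (2 * δ) * u ^ 2 := by positivity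
      have h6 : 0 ≤ (δ / 4 + K ^ 2 * t ^ 2 / (8 * δ)) * (a ^ 2 * h ^ 2) := by positivity
      have h7 : 1 / (4 * δ) * (a ^ 2 * h ^ 2) = 1 / 2 * ((h * a) ^ 2 / (2 * δ)) := by
        field_simp; ring
      have h8 := mul_le_mul_of_nonneg_left h4 (by positivity : 0 ≤ δ / 2)
      rw [h7]; linarith
    · have h3 := young (ψ * (b - a)) (h * a)
      rw [mul_comm (ψ * (b - a))] at h3
      have hψ : ψ ^ 2 ≤ K ^ 2 := by
        rw [← sq_abs ψ]; exact pow_le_pow_left₀ (abs_nonneg _) (not_lt.1 hK) 2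
      have h4 : (ψ * (b - a)) ^ 2 ≤ K ^ 2 * t ^ 2 * (2 * u ^ 2 + h ^ 2 * a ^ 2 / 2) := by
        have e1 : (b - a) ^ 2 ≤ t ^ 2 * (2 * u ^ 2 + h ^ 2 * a ^ 2 / 2) := by
          rw [hb, mul_pow]
          refine mul_le_mul_of_nonneg_left ?_ (sq_nonneg _)
          nlinarith [sq_nonneg (u - 1 / 2 * h * a)]
        rw [mul_pow, mul_assoc]
        exact mul_le_mul hψ e1 (sq_nonneg _) (sq_nonneg _)
      have h5 : (ψ * (b - a)) ^ 2 / (2 * δ) ≤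
          K ^ 2 * t ^ 2 * (2 * u ^ 2 + h ^ 2 * a ^ 2 / 2) / (2 * δ) := by gcongr
      have h6 : 1 / 2 * (K ^ 2 * t ^ 2 * (2 * u ^ 2 + h ^ 2 * a ^ 2 / 2) / (2 * δ))
          = K ^ 2 * t ^ 2 / (2 * δ) * u ^ 2 + K ^ 2 * t ^ 2 / (8 * δ) * (a ^ 2 * h ^ 2) := by
        field_simp; ring
      have h7 : 0 ≤ 1 / 2 * δ * (a ^ 2 * ψ ^ 2 + b ^ 2 * ψ ^ 2) := by positivity
      nlinarith
  have h9 := mul_le_mul_of_nonneg_left h1' (by positivity : 0 ≤ δ / 2)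
  calc _ ≤ _ := abs_add_le _ _
    _ ≤ _ := add_le_add (h1.trans (add_le_add_right h9 _)) h2
    _ = _ := by field_simp; ring

theorem abs_integral_difference_le {P R : Measure W} [IsFiniteMeasure P] [IsFiniteMeasure R]
    {ψ h : W → ℝ} (hh : Measurable h) (hhP : MemLp h 2 P)
    (hψm : Measurable ψ) (hψP : MemLp ψ 2 P) (hψR : MemLp ψ 2 R)
    {t : ℝ} (ht : 0 < t) (hfin : qmdResidual P R h t ≠ ∞) {δ K : ℝ} (hδ : 0 < δ) :
    |(∫ w, ψ w ∂(R) - ∫ w, ψ w ∂P) / t - ∫ w, ψ w * h w ∂P| ≤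
      (1 / (2 * δ) + K ^ 2 * t ^ 2 / (2 * δ)) * (qmdResidual P R h t).toReal
        + 3 / 2 * δ * (∫ w, ψ w ^ 2 ∂P + ∫ w, ψ w ^ 2 ∂(R))
        + (δ / 4 + K ^ 2 * t ^ 2 / (8 * δ)) * ∫ w, h w ^ 2 ∂P
        + 1 / (4 * δ) * ∫ w, (if K < |ψ w| then h w ^ 2 else 0) ∂P := by
  have hP : P ≪ P + R := Measure.absolutelyContinuous_of_le (Measure.le_add_right le_rfl)
  have hR : R ≪ P + R := Measure.absolutelyContinuous_of_le (Measure.le_add_left le_rfl)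
  set μ := P + R with hμ
  set a : W → ℝ := fun w => √((P.rnDeriv μ w).toReal) with ha
  set b : W → ℝ := fun w => √((R.rnDeriv μ w).toReal) with hb
  have ha2 : ∀ w, a w ^ 2 = (P.rnDeriv μ w).toReal := fun w => Real.sq_sqrt ENNReal.toReal_nonneg
  have hb2 : ∀ w, b w ^ 2 = (R.rnDeriv μ w).toReal := fun w => Real.sq_sqrt ENNReal.toReal_nonneg
  have ham : Measurable a := by fun_prop
  have hbm : Measurable b := by fun_prop
  have eP : ∀ f : W → ℝ, ∫ w, a w ^ 2 * f w ∂μ = ∫ w, f w ∂P := fun f => by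
    simp_rw [ha2]; exact integral_rnDeriv_smul hP
  have eR : ∀ f : W → ℝ, ∫ w, b w ^ 2 * f w ∂μ = ∫ w, f w ∂(R) := fun f => by
    simp_rw [hb2]; exact integral_rnDeriv_smul hR
  have iP : ∀ f : W → ℝ, Integrable f P → Integrable (fun w => a w ^ 2 * f w) μ := fun f hf => by
    simp_rw [ha2]; exact (integrable_rnDeriv_smul_iff hP).2 hf
  have iR : ∀ f : W → ℝ, Integrable f R → Integrable (fun w => b w ^ 2 * f w) μ := fun f hf => by
    simp_rw [hb2]; exact (integrable_rnDeriv_smul_iff hR).2 hf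
  set u : W → ℝ := fun w => (b w - a w) / t - 1 / 2 * h w * a w with hu
  have hum : Measurable u := by fun_prop
  have hres : qmdResidual P R h t = ∫⁻ w, ENNReal.ofReal (u w ^ 2) ∂μ := rfl
  have iu : Integrable (fun w => u w ^ 2) μ := by
    refine ⟨by fun_prop, ?_⟩
    rw [hasFiniteIntegral_iff_ofReal (ae_of_all _ fun _ => sq_nonneg _)]
    exact hfin.lt_top
  have eu : (qmdResidual P R h t).toReal = ∫ w, u w ^ 2 ∂μ := by
    rw [hres, integral_eq_lintegral_of_nonneg_ae (ae_of_all _ fun _ => sq_nonneg _) (by fun_prop)]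
  have iψP := hψP.integrable_sq
  have iψR := hψR.integrable_sq
  have ihP := hhP.integrable_sq
  have iT : Integrable (fun w => if K < |ψ w| then h w ^ 2 else 0) P := by
    refine ihP.mono' (Measurable.aestronglyMeasurable ?_) (ae_of_all _ fun w => ?_)
    · exact Measurable.ite (measurableSet_lt measurable_const (by fun_prop)) (by fun_prop)
        measurable_const
    · split_ifs <;> simp [sq_nonneg]
  have iψh : Integrable (fun w => ψ w * h w) P := hψP.integrable_mul hhP
  have i1 : Integrable ψ P := hψP.integrable (by norm_num)
  have i2 : Integrable ψ R := hψR.integrable (by norm_num)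
  have eLHS : (∫ w, ψ w ∂(R) - ∫ w, ψ w ∂P) / t - ∫ w, ψ w * h w ∂P =
      ∫ w, (b w ^ 2 * (ψ w / t) - a w ^ 2 * (ψ w / t) - a w ^ 2 * (ψ w * h w)) ∂μ := by
    rw [integral_sub (f := fun w => b w ^ 2 * (ψ w / t) - a w ^ 2 * (ψ w / t))
        ((iR _ (i2.div_const t)).sub (iP _ (i1.div_const t))) (iP _ iψh), integral_sub (iR _ (i2.div_const t)) (iP _ (i1.div_const t)), eP, eP, eR,
      integral_div, integral_div, sub_div]
  have J1 := iu.const_mul (1 / (2 * δ) + K ^ 2 * t ^ 2 / (2 * δ))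
  have J2 := ((iP _ iψP).add (iR _ iψR)).const_mul (3 / 2 * δ)
  have J3 := (iP _ ihP).const_mul (δ / 4 + K ^ 2 * t ^ 2 / (8 * δ))
  have J4 := (iP _ iT).const_mul (1 / (4 * δ))
  rw [eLHS, ← Real.norm_eq_abs]
  refine (norm_integral_le_of_norm_le (((J1.add J2).add J3).add J4)
    (ae_of_all _ fun w => ?_)).trans_eq ?_
  · exact abs_qmd_difference_le ht hδ
  · rw [integral_add' ((J1.add J2).add J3) J4, integral_add' (J1.add J2) J3, integral_add' J1 J2]
    simp only [integral_const_mul, Pi.add_apply]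
    rw [integral_add (iP _ iψP) (iR _ iψR), eP, eP, eP, eR, eu]

theorem tendsto_integral_tail {P : Measure W} {ψ f : W → ℝ} (hψ : Measurable ψ)
    (hf : Integrable f P) :
    Tendsto (fun n : ℕ => ∫ w, (if (n : ℝ) < |ψ w| then f w else 0) ∂P) atTop (𝓝 0) := by
  suffices h : Tendsto (fun n : ℕ => ∫ w, (if (n : ℝ) < |ψ w| then f w else 0) ∂P) atTop
      (𝓝 (∫ _, (0 : ℝ) ∂P)) by simpa using h
  refine tendsto_integral_of_dominated_convergence (fun w => ‖f w‖) (fun n => ?_) hf.norm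
    (fun n => ae_of_all _ fun w => ?_) (ae_of_all _ fun w => ?_)
  · have : MeasurableSet {w | (n : ℝ) < |ψ w|} := measurableSet_lt measurable_const (by fun_prop)
    exact hf.1.indicator this
  · split_ifs <;> simp
  · obtain ⟨N, hN⟩ := exists_nat_ge |ψ w|
    refine tendsto_const_nhds.congr' ?_
    filter_upwards [eventually_ge_atTop N] with n hn
    have : ¬ ((n : ℝ) < |ψ w|) := not_lt.2 (hN.trans (by exact_mod_cast hn))
    simp [this]

theorem memLp_two_of_lintegral_le {P : Measure W} {ψ : W → ℝ} (hψ : Measurable ψ) {C : ℝ≥0}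
    (hC : ∫⁻ w, ENNReal.ofReal (ψ w ^ 2) ∂P ≤ C) :
    MemLp ψ 2 P ∧ ∫ w, ψ w ^ 2 ∂P ≤ C := by
  constructor
  · rw [memLp_two_iff_integrable_sq hψ.aestronglyMeasurable]
    refine ⟨by fun_prop, ?_⟩
    rw [hasFiniteIntegral_iff_ofReal (ae_of_all _ fun _ => sq_nonneg _)]
    exact hC.trans_lt ENNReal.coe_lt_top
  · rw [integral_eq_lintegral_of_nonneg_ae (ae_of_all _ fun _ => sq_nonneg _) (by fun_prop)]
    exact ENNReal.toReal_le_of_le_ofReal C.2 (by simpa using hC)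

/-- A linear functional `P ↦ ∫ ψ dP` is differentiable along every path that is differentiable in
quadratic mean and along which the second moment of `ψ` is bounded. -/
theorem HasScore.tendsto_integral {P : Measure W} [IsFiniteMeasure P] {γ : ℝ → Measure W}
    {h ψ : W → ℝ} (hs : HasScore P γ h) (hψ : Measurable ψ) {C : ℝ≥0}
    (hPC : ∫⁻ w, ENNReal.ofReal (ψ w ^ 2) ∂P ≤ C)
    (hγ : ∀ᶠ t in 𝓝[>] (0 : ℝ), IsFiniteMeasure (γ t) ∧
      ∫⁻ w, ENNReal.ofReal (ψ w ^ 2) ∂(γ t) ≤ C) :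
    Tendsto (fun t : ℝ => (∫ w, ψ w ∂(γ t) - ∫ w, ψ w ∂P) / t) (𝓝[>] 0)
      (𝓝 (∫ w, ψ w * h w ∂P)) := by
  wlog hh : Measurable h generalizing h
  · have hae := hs.1.1.ae_eq_mk
    have := this (hs.congr (hγ.mono fun t ht => ht.1) hae) hs.1.1.stronglyMeasurable_mk.measurable
    have e : ∫ w, ψ w * h w ∂P = ∫ w, ψ w * hs.1.1.mk h w ∂P :=
      integral_congr_ae (hae.mono fun w hw => by dsimp only; rw [← hw])
    rwa [e]
  obtain ⟨hψP, hψP'⟩ := memLp_two_of_lintegral_le hψ hPC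
  rw [Metric.tendsto_nhds]
  intro e he
  set H := ∫ w, h w ^ 2 ∂P with hH
  have hH0 : 0 ≤ H := integral_nonneg fun _ => sq_nonneg _
  -- Order of choices: `δ` makes the terms that survive `t → 0` small, then the truncation level `n`
  -- beats the factor `1 / (4δ)`, and only then `t` tends to zero.
  obtain ⟨δ, hδ, hδe⟩ : ∃ δ : ℝ, 0 < δ ∧ 3 * C * δ + δ / 4 * H < e / 2 := by
    refine ⟨e / (4 * (3 * C + H / 4 + 1)), by positivity, ?_⟩
    have hC0 : 0 ≤ (C : ℝ) := C.2
    have hD : 0 < 3 * (C : ℝ) + H / 4 + 1 := by positivity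
    have : 3 * (C : ℝ) * (e / (4 * (3 * C + H / 4 + 1))) + e / (4 * (3 * C + H / 4 + 1)) / 4 * H
        = e / 4 * ((3 * C + H / 4) / (3 * C + H / 4 + 1)) := by field_simp
    rw [this]
    have : (3 * (C : ℝ) + H / 4) / (3 * C + H / 4 + 1) ≤ 1 := by
      rw [div_le_one hD]; linarith
    nlinarith
  obtain ⟨n, hn⟩ : ∃ n : ℕ,
      1 / (4 * δ) * ∫ w, (if (n : ℝ) < |ψ w| then h w ^ 2 else 0) ∂P < e / 2 := by
    have := (tendsto_integral_tail hψ hs.1.integrable_sq).const_mul (1 / (4 * δ))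
    rw [mul_zero] at this
    exact (this.eventually_lt_const (half_pos he)).exists
  set T := ∫ w, (if (n : ℝ) < |ψ w| then h w ^ 2 else 0) ∂P with hT
  have hr : Tendsto (fun t => (qmdResidual P (γ t) h t).toReal) (𝓝[>] 0) (𝓝 0) := by
    exact (ENNReal.tendsto_toReal ENNReal.zero_ne_top).comp hs.2
  have ht0 : Tendsto (fun t : ℝ => t) (𝓝[>] 0) (𝓝 0) := nhdsWithin_le_nhds
  have hF : Tendsto (fun t : ℝ =>
      (1 / (2 * δ) + (n : ℝ) ^ 2 * t ^ 2 / (2 * δ)) * (qmdResidual P (γ t) h t).toReal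
        + 3 / 2 * δ * (C + C) + (δ / 4 + (n : ℝ) ^ 2 * t ^ 2 / (8 * δ)) * H + 1 / (4 * δ) * T)
      (𝓝[>] 0) (𝓝 ((1 / (2 * δ) + (n : ℝ) ^ 2 * 0 ^ 2 / (2 * δ)) * 0
        + 3 / 2 * δ * (C + C) + (δ / 4 + (n : ℝ) ^ 2 * 0 ^ 2 / (8 * δ)) * H + 1 / (4 * δ) * T)) :=
    ((((((ht0.pow 2).const_mul _).div_const _).const_add _).mul hr).add_const _ |>.add
      (((((ht0.pow 2).const_mul _).div_const _).const_add _).mul_const _)).add_const _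
  have hlt : (1 / (2 * δ) + (n : ℝ) ^ 2 * 0 ^ 2 / (2 * δ)) * 0
        + 3 / 2 * δ * (C + C) + (δ / 4 + (n : ℝ) ^ 2 * 0 ^ 2 / (8 * δ)) * H + 1 / (4 * δ) * T
        < e := by
    simp only [mul_zero, ne_eq, OfNat.ofNat_ne_zero, not_false_eq_true, zero_pow, zero_div,
      add_zero, zero_add]
    linarith
  filter_upwards [hγ, self_mem_nhdsWithin, hF.eventually_lt_const hlt,
    hs.2.eventually_lt_const ENNReal.zero_lt_top] with t ht htpos htF hfin
  obtain ⟨hfinite, htC⟩ := ht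
  obtain ⟨hψR, hψR'⟩ := memLp_two_of_lintegral_le hψ htC
  rw [Real.dist_eq]
  refine (abs_integral_difference_le hh hs.1 hψ hψP hψR htpos hfin.ne hδ (K := n)).trans_lt
    (lt_of_le_of_lt ?_ htF)
  gcongr

/-- With `s = √(1 + t k)` one has `(s - 1) / t - k / 2 = -(s - 1)² / (2t)`, and `|s - 1| ≤ |t k|`,
so the residual is at most `t² B⁴ / 4` times the mass of `P`. -/
theorem hasScore_withDensity {P : Measure W} [IsFiniteMeasure P] {γ : ℝ → Measure W}
    {k : W → ℝ} (hk : Measurable k) {B : ℝ} (hB : ∀ w, |k w| ≤ B)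
    (hγ : ∀ᶠ t in 𝓝[>] (0 : ℝ), γ t = P.withDensity fun w => ENNReal.ofReal (1 + t * k w)) :
    HasScore P γ k := by
  refine ⟨MemLp.of_bound hk.aestronglyMeasurable B (ae_of_all _ hB), ?_⟩
  have ht0 : Tendsto (fun t : ℝ => t) (𝓝[>] 0) (𝓝 0) := nhdsWithin_le_nhds
  have hlim : Tendsto (fun t : ℝ => ENNReal.ofReal (t ^ 2 * B ^ 4 / 4) * P Set.univ) (𝓝[>] 0)
      (𝓝 0) := by
    have h1 : Tendsto (fun t : ℝ => t ^ 2 * B ^ 4 / 4) (𝓝[>] 0) (𝓝 (0 ^ 2 * B ^ 4 / 4)) :=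
      ((ht0.pow 2).mul_const _).div_const _
    have h2 := ENNReal.Tendsto.mul_const (b := P Set.univ) (ENNReal.tendsto_ofReal h1)
      (Or.inr (measure_ne_top _ _))
    simpa using h2
  refine tendsto_of_tendsto_of_tendsto_of_le_of_le' tendsto_const_nhds hlim
    (Eventually.of_forall fun _ => zero_le) ?_
  have hsmall : ∀ᶠ t : ℝ in 𝓝[>] 0, t * B < 1 := by
    have := ht0.mul_const B
    rw [zero_mul] at this
    exact this.eventually_lt_const one_pos
  filter_upwards [hγ, self_mem_nhdsWithin, hsmall] with t hγt htpos htB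
  have htpos : 0 < t := htpos
  have hc0 : ∀ w, 0 ≤ 1 + t * k w := fun w => by
    have := abs_le.1 (hB w)
    nlinarith
  set c : W → ℝ≥0∞ := fun w => ENNReal.ofReal (1 + t * k w) with hc
  have hcm : Measurable c := by fun_prop
  -- `d` is the density of `P + γ t` with respect to `P`; relative to `P + γ t` the two measures
  -- thus have densities `1 / d` and `c / d`.
  set d : W → ℝ≥0∞ := fun w => 1 + c w with hd
  have hdm : Measurable d := by fun_prop
  have hd0 : ∀ w, d w ≠ 0 := fun w => by simp [hd]
  have hdt : ∀ w, d w ≠ ∞ := fun w => by simp [hd, hc]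
  have hμ : P + γ t = P.withDensity d := by
    have : d = (1 : W → ℝ≥0∞) + c := rfl
    rw [this, withDensity_add_left measurable_one, withDensity_one, hγt]
  have hP : P = (P + γ t).withDensity (fun w => (d w)⁻¹) := by
    rw [hμ, withDensity_inv_same hdm (ae_of_all _ hd0) (ae_of_all _ hdt)]
  have hR : γ t = (P + γ t).withDensity (fun w => (d w)⁻¹ * c w) := by
    have h1 := withDensity_mul (P + γ t) hdm.inv hcm
    have h2 : (P + γ t).withDensity d⁻¹ = P := hP.symm
    rw [h2] at h1
    exact hγt.trans h1.symm
  have : IsFiniteMeasure (γ t) := by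
    rw [hγt]
    refine isFiniteMeasure_withDensity_ofReal (Integrable.hasFiniteIntegral ?_)
    refine (integrable_const (1 + t * B)).mono' (by fun_prop) (ae_of_all _ fun w => ?_)
    rw [Real.norm_eq_abs, abs_of_nonneg (hc0 w)]
    gcongr
    exact (abs_le.1 (hB w)).2
  have hP' := Measure.rnDeriv_withDensity (P + γ t) hdm.inv
  have hR' := Measure.rnDeriv_withDensity (P + γ t) (hdm.inv.mul hcm)
  have hP'' : P.rnDeriv (P + γ t) =ᵐ[P + γ t] fun w => (d w)⁻¹ := by
    have e : P.rnDeriv (P + γ t) = ((P + γ t).withDensity (fun w => (d w)⁻¹)).rnDeriv (P + γ t) := by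
      rw [← hP]
    rw [e]; exact hP'
  have hR'' : (γ t).rnDeriv (P + γ t) =ᵐ[P + γ t] fun w => (d w)⁻¹ * c w := by
    have e : (γ t).rnDeriv (P + γ t)
        = ((P + γ t).withDensity (fun w => (d w)⁻¹ * c w)).rnDeriv (P + γ t) := by
      rw [← hR]
    rw [e]; exact hR'
  have hbound : ∀ w, ENNReal.ofReal (((√(((d w)⁻¹ * c w).toReal) - √(((d w)⁻¹).toReal)) / t
      - 1 / 2 * k w * √(((d w)⁻¹).toReal)) ^ 2) ≤ (d w)⁻¹ * ENNReal.ofReal (t ^ 2 * B ^ 4 / 4) := by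
    intro w
    have hi : (d w)⁻¹ ≠ ∞ := ENNReal.inv_ne_top.2 (hd0 w)
    have hcr : (c w).toReal = 1 + t * k w := ENNReal.toReal_ofReal (hc0 w)
    refine le_of_le_of_eq (b := ENNReal.ofReal (((d w)⁻¹).toReal * (t ^ 2 * B ^ 4 / 4))) ?_
      (by rw [ENNReal.ofReal_mul ENNReal.toReal_nonneg, ENNReal.ofReal_toReal hi])
    refine ENNReal.ofReal_le_ofReal ?_
    rw [ENNReal.toReal_mul, hcr, Real.sqrt_mul ENNReal.toReal_nonneg]
    set y := ((d w)⁻¹).toReal with hy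
    have hy0 : 0 ≤ y := ENNReal.toReal_nonneg
    have hsq : √y ^ 2 = y := Real.sq_sqrt hy0
    set s := √(1 + t * k w) with hs
    have hs2 : s ^ 2 = 1 + t * k w := Real.sq_sqrt (hc0 w)
    have hs0 : 0 ≤ s := Real.sqrt_nonneg _
    have hkk : k w = (s ^ 2 - 1) / t := by rw [hs2]; field_simp; ring
    have e1 : ((√y * s - √y) / t - 1 / 2 * k w * √y) ^ 2 = y * ((s - 1) ^ 4 / (4 * t ^ 2)) := by
      rw [hkk]; conv_rhs => rw [← hsq]
      field_simp; ring
    rw [e1]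
    refine mul_le_mul_of_nonneg_left ?_ hy0
    have e2 : (s - 1) ^ 2 ≤ (t * k w) ^ 2 := by
      have : t * k w = (s - 1) * (s + 1) := by rw [hkk]; field_simp; ring
      rw [this, mul_pow]
      have : 1 ≤ (s + 1) ^ 2 := by nlinarith
      nlinarith [sq_nonneg (s - 1)]
    have e3 : (s - 1) ^ 4 ≤ t ^ 4 * B ^ 4 := by
      have e4 : (t * k w) ^ 2 ≤ t ^ 2 * B ^ 2 := by
        rw [mul_pow, ← sq_abs (k w)]
        gcongr
        exact hB w
      calc (s - 1) ^ 4 = ((s - 1) ^ 2) ^ 2 := by ring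
        _ ≤ (t ^ 2 * B ^ 2) ^ 2 := by gcongr; exact e2.trans e4
        _ = _ := by ring
    rw [div_le_div_iff₀ (by positivity) (by norm_num)]
    nlinarith
  calc qmdResidual P (γ t) k t
      ≤ ∫⁻ w, (d w)⁻¹ * ENNReal.ofReal (t ^ 2 * B ^ 4 / 4) ∂(P + γ t) := by
        refine lintegral_mono_ae ?_
        filter_upwards [hP'', hR''] with w h1 h2
        rw [h1, h2]
        exact hbound w
    _ = ∫⁻ _, ENNReal.ofReal (t ^ 2 * B ^ 4 / 4) ∂P := by
        conv_rhs => rw [hP]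
        rw [lintegral_withDensity_eq_lintegral_mul (P + γ t) (f := fun w => (d w)⁻¹) hdm.inv
          measurable_const]
        rfl
    _ ≤ _ := by rw [lintegral_const]

theorem isEfficientInfluenceFunction_iff_ae_eq {P : Measure W} {paths : Set (ℝ → Measure W)}
    {θ : Measure W → ℝ} {φ₀ : W → ℝ} (h₀ : IsEfficientInfluenceFunction P paths θ φ₀)
    (φ : W → ℝ) : IsEfficientInfluenceFunction P paths θ φ ↔ φ =ᵐ[P] φ₀ := by
  obtain ⟨⟨hL₀, hI₀⟩, hφ₀, hT₀⟩ := h₀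
  constructor
  · rintro ⟨⟨hL, hI⟩, hφ, hT⟩
    set D := hφ.toLp φ - hφ₀.toLp φ₀ with hD
    have hDT : D ∈ tangentSpace P paths := sub_mem hT hT₀
    have horth : ∀ s ∈ tangentSet P paths, inner ℝ D s = 0 := by
      rintro s ⟨γ, hγ, hs⟩
      have e := tendsto_nhds_unique (hI γ hγ s hs) (hI₀ γ hγ s hs)
      rw [hD, inner_sub_left, sub_eq_zero, L2.inner_def, L2.inner_def]
      calc _ = ∫ w, φ w * s w ∂P := by
            refine integral_congr_ae ?_
            filter_upwards [hφ.coeFn_toLp] with w hw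
            simp [hw, mul_comm]
        _ = ∫ w, φ₀ w * s w ∂P := e
        _ = _ := by
            refine integral_congr_ae ?_
            filter_upwards [hφ₀.coeFn_toLp] with w hw
            simp [hw, mul_comm]
    have hspan : Submodule.span ℝ (tangentSet P paths) ≤ (Submodule.span ℝ {D})ᗮ := by
      rw [Submodule.span_le]
      intro s hs
      rw [SetLike.mem_coe, Submodule.mem_orthogonal_singleton_iff_inner_right]
      exact horth s hs
    have hcl : tangentSpace P paths ≤ (Submodule.span ℝ {D})ᗮ :=
      Submodule.topologicalClosure_minimal _ hspan (Submodule.isClosed_orthogonal _)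
    have h0 := (Submodule.mem_orthogonal_singleton_iff_inner_right).1 (hcl hDT)
    rw [inner_self_eq_zero, hD, sub_eq_zero] at h0
    exact (MemLp.toLp_eq_toLp_iff hφ hφ₀).1 h0
  · intro hae
    have hφ : MemLp φ 2 P := hφ₀.ae_eq hae.symm
    refine ⟨⟨hφ, fun γ hγ h hs => ?_⟩, hφ, ?_⟩
    · have e : ∫ w, φ w * h w ∂P = ∫ w, φ₀ w * h w ∂P :=
        integral_congr_ae (hae.mono fun w hw => by dsimp only; rw [hw])
      rw [e]
      exact hI₀ γ hγ h hs
    · rwa [(MemLp.toLp_eq_toLp_iff hφ hφ₀).2 hae]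

end Semiparametric

end

/-! ### Missingness at random as a single conditional-expectation identity. -/

noncomputable section

namespace MARS

section CondIndep

variable {Ω α β : Type*} {mΩ : MeasurableSpace Ω} [mα : MeasurableSpace α] [mβ : MeasurableSpace β]
  {Q : Measure Ω}

/-- A π-λ argument: rectangles are a generating π-system, and integrability carries the equality
through complements and disjoint unions. -/
theorem setIntegral_preimage_eq_of_rectangles {X : Ω → α} {Y : Ω → β} (hX : Measurable X)
    (hY : Measurable Y) {f g : Ω → ℝ} (hf : Integrable f Q) (hg : Integrable g Q)
    (h : ∀ s t, MeasurableSet s → MeasurableSet t →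
      ∫ ω in X ⁻¹' s ∩ Y ⁻¹' t, f ω ∂Q = ∫ ω in X ⁻¹' s ∩ Y ⁻¹' t, g ω ∂Q)
    {S : Set (α × β)} (hS : MeasurableSet S) :
    ∫ ω in (fun ω => (X ω, Y ω)) ⁻¹' S, f ω ∂Q = ∫ ω in (fun ω => (X ω, Y ω)) ⁻¹' S, g ω ∂Q := by
  have hXY : Measurable fun ω => (X ω, Y ω) := hX.prodMk hY
  induction S, hS using MeasurableSpace.induction_on_inter generateFrom_prod.symm isPiSystem_prod with
  | empty => simp
  | basic S hS =>
    obtain ⟨s, hs, t, ht, rfl⟩ := hS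
    exact h s t hs ht
  | compl S hS ih =>
    have htot := h _ _ MeasurableSet.univ MeasurableSet.univ
    simp only [Set.preimage_univ, Set.univ_inter, setIntegral_univ] at htot
    rw [Set.preimage_compl, setIntegral_compl (hXY hS) hf, setIntegral_compl (hXY hS) hg, ih, htot]
  | iUnion S hd hS ih =>
    have hd' : Pairwise (Function.onFun Disjoint fun i => (fun ω => (X ω, Y ω)) ⁻¹' S i) :=
      fun i j hij => (hd hij).preimage _
    rw [Set.preimage_iUnion, integral_iUnion (fun i => hXY (hS i)) hd' hf.integrableOn,
      integral_iUnion (fun i => hXY (hS i)) hd' hg.integrableOn]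
    simp_rw [ih]

theorem integrable_boole [IsFiniteMeasure Q] {A : Ω → Bool} (hA : Measurable A) :
    Integrable (fun ω => if A ω then (1 : ℝ) else 0) Q := by
  refine (integrable_const (1 : ℝ)).mono' (Measurable.aestronglyMeasurable ?_)
    (ae_of_all _ fun ω => by split_ifs <;> simp)
  exact Measurable.ite (hA (measurableSet_singleton true)) measurable_const measurable_const

/-- Conditioning in addition on a variable that is conditionally independent of `A` does not
change the conditional probability of `A`. -/
theorem condExp_prodMk_of_condIndepFun [StandardBorelSpace Ω] [IsFiniteMeasure Q] {X : Ω → α}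
    {Y : Ω → β} {A : Ω → Bool} (hX : Measurable X) (hY : Measurable Y) (hA : Measurable A)
    (h : CondIndepFun (mα.comap X) hX.comap_le Y A Q) :
    Q[fun ω => if A ω then (1 : ℝ) else 0 | MeasurableSpace.comap (fun ω => (X ω, Y ω)) inferInstance]
      =ᵐ[Q] Q[fun ω => if A ω then (1 : ℝ) else 0 | mα.comap X] := by
  set a : Ω → ℝ := fun ω => if A ω then 1 else 0 with ha
  have hai : Integrable a Q := integrable_boole hA
  have hle : mα.comap X ≤ MeasurableSpace.comap (fun ω => (X ω, Y ω)) inferInstance := by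
    rintro _ ⟨s, hs, rfl⟩
    exact ⟨Prod.fst ⁻¹' s, measurable_fst hs, rfl⟩
  have hXY : Measurable fun ω => (X ω, Y ω) := hX.prodMk hY
  refine (ae_eq_condExp_of_forall_setIntegral_eq hXY.comap_le hai
    (fun _ _ _ => integrable_condExp.integrableOn) ?_
    (stronglyMeasurable_condExp.mono hle).aestronglyMeasurable).symm
  rintro _ ⟨S, hS, rfl⟩ -
  refine setIntegral_preimage_eq_of_rectangles hX hY integrable_condExp hai
    (fun s t hs ht => ?_) hS
  have hst := (condIndepFun_iff_condExp_inter_preimage_eq_mul hY hA).1 h t {true} ht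
    (measurableSet_singleton _)
  have hYt := hY ht
  have e1 : ((Y ⁻¹' t ∩ A ⁻¹' {true}).indicator fun _ => (1 : ℝ)) = (Y ⁻¹' t).indicator a := by
    ext ω
    by_cases h1 : ω ∈ Y ⁻¹' t <;> by_cases h2 : A ω = true <;> simp [ha, h2, h1]
  have e2 : ((A ⁻¹' {true}).indicator fun _ => (1 : ℝ)) = a := by
    ext ω
    by_cases h2 : A ω = true <;> simp [ha, h2]
  rw [e1, e2] at hst
  have hm := hX.comap_le
  have hsm : MeasurableSet[mα.comap X] (X ⁻¹' s) := ⟨s, hs, rfl⟩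
  set q := Q[a | mα.comap X] with hq
  have hqi : Integrable q Q := integrable_condExp
  have h1i : Integrable ((Y ⁻¹' t).indicator fun _ => (1 : ℝ)) Q :=
    (integrable_const 1).indicator hYt
  have e3 : (Y ⁻¹' t).indicator q = ((Y ⁻¹' t).indicator fun _ => (1 : ℝ)) * q := by
    ext ω
    by_cases h1 : ω ∈ Y ⁻¹' t <;> simp [h1]
  have hpull : Q[(Y ⁻¹' t).indicator q | mα.comap X]
      =ᵐ[Q] Q[(Y ⁻¹' t).indicator fun _ => (1 : ℝ) | mα.comap X] * q := by
    rw [e3]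
    exact condExp_mul_of_stronglyMeasurable_right stronglyMeasurable_condExp
      (e3 ▸ hqi.indicator hYt) h1i
  -- Both integrals become integrals over an `X`-event of conditional expectations given `X`, of
  -- `1{Y ∈ t} q` and `1{Y ∈ t} a`; conditional independence says that these agree.
  rw [← setIntegral_indicator hYt, ← setIntegral_indicator hYt,
    ← setIntegral_condExp hm (hqi.indicator hYt) hsm,
    ← setIntegral_condExp hm (hai.indicator hYt) hsm]
  refine setIntegral_congr_ae (hm _ hsm) ?_
  filter_upwards [hpull, hst] with ω h1 h2 _
  rw [h1, h2]; rfl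

theorem condExp_of_le_of_stronglyMeasurable {m' G mΩ : MeasurableSpace Ω} {Q : Measure Ω}
    [IsFiniteMeasure Q] (hm : m' ≤ G) (hG : G ≤ mΩ) {a q : Ω → ℝ} (hq : StronglyMeasurable[m'] q)
    (hqi : Integrable q Q) (haq : Q[a | G] =ᵐ[Q] q) : Q[a | m'] =ᵐ[Q] q :=
  calc Q[a | m'] =ᵐ[Q] Q[Q[a | G] | m'] := (condExp_condExp_of_le hm hG).symm
    _ =ᵐ[Q] Q[q | m'] := condExp_congr_ae haq
    _ = q := condExp_of_stronglyMeasurable (hm.trans hG) hq hqi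

/-- If the conditional probability of `A` given `G` is measurable with respect to `m'`, then every
`G`-measurable variable is independent of `A` given `m'`. -/
theorem condIndepFun_of_condExp_eq {m' G mΩ : MeasurableSpace Ω} [StandardBorelSpace Ω]
    {Q : Measure Ω} [IsFiniteMeasure Q] (hm : m' ≤ G) (hG : G ≤ mΩ) {Y : Ω → β} {A : Ω → Bool}
    (hY : Measurable[G] Y) (hA : Measurable A) {q : Ω → ℝ} (hq : StronglyMeasurable[m'] q)
    (hqi : Integrable q Q) (h : Q[fun ω => if A ω then (1 : ℝ) else 0 | G] =ᵐ[Q] q) :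
    CondIndepFun m' (hm.trans hG) Y A Q := by
  have hY' : Measurable Y := hY.mono hG le_rfl
  rw [condIndepFun_iff_condExp_inter_preimage_eq_mul hY' hA]
  intro s T hs hT
  set a : Ω → ℝ := fun ω => if A ω then 1 else 0 with ha
  have hai : Integrable a Q := integrable_boole hA
  set b : Ω → ℝ := (A ⁻¹' T).indicator fun _ => 1 with hb
  have hbi : Integrable b Q := (integrable_const 1).indicator (hA hT)
  -- `A` has two values, so the indicator of any event `A ∈ T` is affine in `a`, and its conditional
  -- expectation given `G` is again `m'`-measurable.
  obtain ⟨c, d, hcd⟩ : ∃ c d : ℝ, b = (fun _ => c) + d • a := by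
    classical
    refine ⟨T.indicator 1 false, T.indicator 1 true - T.indicator 1 false, ?_⟩
    ext ω
    cases h : A ω <;> simp [hb, ha, h, Set.indicator]
  set r : Ω → ℝ := (fun _ => c) + d • q with hr
  have hrm : StronglyMeasurable[m'] r := stronglyMeasurable_const.add (hq.const_smul d)
  have hri : Integrable r Q := (integrable_const c).add (hqi.smul d)
  have hbG : Q[b | G] =ᵐ[Q] r := by
    rw [hcd]
    have h1 := condExp_add (integrable_const (μ := Q) c) (hai.smul d) G
    have h2 := condExp_smul (μ := Q) d a G
    rw [condExp_const hG] at h1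
    filter_upwards [h1, h2, h] with ω h1 h2 h3
    rw [h1, Pi.add_apply, h2, hr]
    simp [h3]
  have hbm := condExp_of_le_of_stronglyMeasurable hm hG hrm hri hbG
  have hsG : MeasurableSet[G] (Y ⁻¹' s) := hY hs
  have hsΩ := hG _ hsG
  have h1i : Integrable ((Y ⁻¹' s).indicator fun _ => (1 : ℝ)) Q :=
    (integrable_const 1).indicator hsΩ
  have e1 : ((Y ⁻¹' s ∩ A ⁻¹' T).indicator fun _ => (1 : ℝ)) = (Y ⁻¹' s).indicator b := by
    rw [hb, Set.indicator_indicator]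
  have e3 : (Y ⁻¹' s).indicator r = ((Y ⁻¹' s).indicator fun _ => (1 : ℝ)) * r := by
    ext ω
    by_cases h1 : ω ∈ Y ⁻¹' s <;> simp [h1]
  rw [e1]
  calc Q[(Y ⁻¹' s).indicator b | m']
      =ᵐ[Q] Q[Q[(Y ⁻¹' s).indicator b | G] | m'] := (condExp_condExp_of_le hm hG).symm
    _ =ᵐ[Q] Q[(Y ⁻¹' s).indicator r | m'] := by
        refine condExp_congr_ae ((condExp_indicator hbi hsG).trans ?_)
        filter_upwards [hbG] with ω hω
        simp [Set.indicator, hω]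
    _ =ᵐ[Q] Q[(Y ⁻¹' s).indicator fun _ => (1 : ℝ) | m'] * r := by
        rw [e3]
        exact condExp_mul_of_stronglyMeasurable_right hrm (e3 ▸ hri.indicator hsΩ) h1i
    _ =ᵐ[Q] _ := by
        filter_upwards [hbm] with ω hω
        rw [Pi.mul_apply, hω]

end CondIndep

variable {E 𝓧 𝓤 𝓥 : Type*}

/-- All the coordinates of the full data except the annotation indicator. -/
def unannotated (w : Data E 𝓧 𝓤 𝓥) : (𝓧 × 𝓤 × E) × 𝓥 :=
  ((covX w, unstr w, structured w), ctx w)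

variable [MeasurableSpace E] [MeasurableSpace 𝓧] [MeasurableSpace 𝓤] [MeasurableSpace 𝓥]

theorem measurable_unannotated : Measurable (unannotated : Data E 𝓧 𝓤 𝓥 → _) := by
  unfold unannotated covX unstr structured ctx; fun_prop

theorem measurable_annotated : Measurable (annotated : Data E 𝓧 𝓤 𝓥 → _) := by
  unfold annotated; fun_prop

theorem measurable_ctx : Measurable (ctx : Data E 𝓧 𝓤 𝓥 → _) := by
  unfold ctx; fun_prop

theorem measurable_features : Measurable (features : Data E 𝓧 𝓤 𝓥 → _) := by
  unfold features covX unstr ctx; fun_prop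

theorem measurable_annot : Measurable (annot : Data E 𝓧 𝓤 𝓥 → ℝ) :=
  Measurable.ite (measurable_annotated (measurableSet_singleton true)) measurable_const
    measurable_const

theorem measurable_transformed {g : E → 𝓥 → ℝ} (hg : Measurable (Function.uncurry g)) :
    Measurable (transformed g : Data E 𝓧 𝓤 𝓥 → ℝ) := by
  have : (transformed g : Data E 𝓧 𝓤 𝓥 → ℝ)
      = fun w => Function.uncurry g (structured w, ctx w) := rfl
  rw [this]; unfold structured ctx; fun_prop

theorem integrable_score {π : 𝓧 → ℝ} (hπ : Measurable π) {η : ℝ} (hη : 0 < η)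
    (hπ_mem : ∀ x, π x ∈ Set.Icc η 1) (Q : Measure (Data E 𝓧 𝓤 𝓥)) [IsFiniteMeasure Q] :
    Integrable (fun w => π (covX w)) Q := by
  refine (integrable_const (1 : ℝ)).mono' (hπ.comp measurable_covX).aestronglyMeasurable
    (ae_of_all _ fun w => ?_)
  rw [Real.norm_eq_abs, abs_of_nonneg (hη.le.trans (hπ_mem _).1)]
  exact (hπ_mem _).2

theorem comap_covX_le : MeasurableSpace.comap (covX : Data E 𝓧 𝓤 𝓥 → 𝓧) inferInstance ≤
    MeasurableSpace.comap unannotated inferInstance := by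
  rintro _ ⟨s, hs, rfl⟩
  exact ⟨(fun z => z.1.1) ⁻¹' s, (measurable_fst.comp measurable_fst) hs, rfl⟩

theorem comap_covX_unstr_structured_le :
    MeasurableSpace.comap (fun w : Data E 𝓧 𝓤 𝓥 => (covX w, unstr w, structured w)) inferInstance ≤
    MeasurableSpace.comap unannotated inferInstance := by
  rintro _ ⟨s, hs, rfl⟩
  exact ⟨(fun z => z.1) ⁻¹' s, measurable_fst hs, rfl⟩

variable [StandardBorelSpace E] [StandardBorelSpace 𝓧] [StandardBorelSpace 𝓤]
  [StandardBorelSpace 𝓥]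

/-- Independence of the context removes `V` from the conditioning, missingness at random then
removes `(U, M*)`, and the known score identifies what is left. The nesting in `unannotated` makes
it literally the pair `((X, U, M*), V)`. -/
theorem IsFullDataLaw.condExp_annot {𝓜 : Set E} {g : E → 𝓥 → ℝ} {π : 𝓧 → ℝ}
    {Q : Measure (Data E 𝓧 𝓤 𝓥)} [IsProbabilityMeasure Q] (h : IsFullDataLaw 𝓜 g π Q) :
    Q[annot | MeasurableSpace.comap unannotated inferInstance] =ᵐ[Q] fun w => π (covX w) := by
  have h1 := condExp_prodMk_of_condIndepFun measurable_covX
    (by unfold unstr structured; fun_prop) measurable_annotated h.mar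
  have h2 := condExp_prodMk_of_condIndepFun measurable_covX_unstr_structured
    measurable_ctx measurable_annotated h.ctx_indep
  exact h2.trans (h1.trans h.score)

/-- Converse of `IsFullDataLaw.condExp_annot`. Two conditional independences and the score condition
reduce to one identity, which is easy to check after a change of density. -/
theorem isFullDataLaw_of_condExp_annot {𝓜 : Set E} {g : E → 𝓥 → ℝ} {π : 𝓧 → ℝ}
    (hπ : Measurable π) {Q : Measure (Data E 𝓧 𝓤 𝓥)} [IsProbabilityMeasure Q]
    (hπi : Integrable (fun w => π (covX w)) Q)
    (h𝓜 : ∀ᵐ w ∂Q, structured w ∈ 𝓜) (hg : MemLp (transformed g) 2 Q)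
    (h : Q[annot | MeasurableSpace.comap unannotated inferInstance] =ᵐ[Q] fun w => π (covX w)) :
    IsFullDataLaw 𝓜 g π Q := by
  have hle : MeasurableSpace.comap (covX : Data E 𝓧 𝓤 𝓥 → 𝓧) inferInstance ≤
      MeasurableSpace.comap (fun w : Data E 𝓧 𝓤 𝓥 => (covX w, unstr w, structured w))
        inferInstance := by
    rintro _ ⟨s, hs, rfl⟩
    exact ⟨Prod.fst ⁻¹' s, measurable_fst hs, rfl⟩
  have hq : StronglyMeasurable[MeasurableSpace.comap covX inferInstance]
      (fun w : Data E 𝓧 𝓤 𝓥 => π (covX w)) :=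
    (hπ.comp (comap_measurable covX)).stronglyMeasurable
  refine ⟨h𝓜, ?_, ?_, ?_, hg⟩
  · exact condIndepFun_of_condExp_eq comap_covX_le measurable_unannotated.comap_le
      
      (fun s hs => ⟨(fun z => z.1.2) ⁻¹' s, (measurable_snd.comp measurable_fst) hs, rfl⟩)
      measurable_annotated hq hπi h
  · exact condIndepFun_of_condExp_eq comap_covX_unstr_structured_le measurable_unannotated.comap_le
      (fun s hs => ⟨(fun z => z.2) ⁻¹' s, measurable_snd hs, rfl⟩)
      measurable_annotated (hq.mono hle) hπi h
  · exact condExp_of_le_of_stronglyMeasurable comap_covX_le measurable_unannotated.comap_le hq hπi h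

end MARS

end

/-! ### Inverse probability weighting and linearity of the mean functional. -/

noncomputable section

namespace MARS

section InverseProbabilityWeighting

variable {Ω : Type*} {m mΩ : MeasurableSpace Ω} {Q : Measure Ω} [IsFiniteMeasure Q] {a p : Ω → ℝ}

theorem integral_mul_of_condExp_eq (hm : m ≤ mΩ) (ha : Integrable a Q) (hab : ∀ ω, |a ω| ≤ 1)
    (h : Q[a | m] =ᵐ[Q] p) {F : Ω → ℝ} (hFm : StronglyMeasurable[m] F) (hF : Integrable F Q) :
    ∫ ω, F ω * a ω ∂Q = ∫ ω, F ω * p ω ∂Q := by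
  have hFa : Integrable (F * a) Q :=
    hF.mul_bdd ha.1 (ae_of_all _ fun ω => (by simpa using hab ω : ‖a ω‖ ≤ 1))
  calc ∫ ω, F ω * a ω ∂Q = ∫ ω, (Q[F * a | m]) ω ∂Q := (integral_condExp hm).symm
    _ = ∫ ω, F ω * p ω ∂Q := by
      refine integral_congr_ae ?_
      filter_upwards [condExp_mul_of_stronglyMeasurable_left hFm hFa ha, h] with ω h1 h2
      rw [h1, Pi.mul_apply, h2]

theorem integral_div_mul_of_condExp_eq (hm : m ≤ mΩ) (ha : Integrable a Q) (hab : ∀ ω, |a ω| ≤ 1)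
    (h : Q[a | m] =ᵐ[Q] p) (hp : StronglyMeasurable[m] p) {η : ℝ} (hη : 0 < η)
    (hηp : ∀ ω, η ≤ p ω) {F : Ω → ℝ} (hFm : StronglyMeasurable[m] F) (hF : Integrable F Q) :
    ∫ ω, F ω * (a ω / p ω) ∂Q = ∫ ω, F ω ∂Q := by
  have hp0 : ∀ ω, 0 < p ω := fun ω => hη.trans_le (hηp ω)
  have hm1 : StronglyMeasurable[m] fun ω => (p ω)⁻¹ := hp.measurable.inv.stronglyMeasurable
  have hFp : Integrable (fun ω => F ω * (p ω)⁻¹) Q := by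
    refine hF.mul_bdd (c := η⁻¹) (hm1.mono hm).aestronglyMeasurable (ae_of_all _ fun ω => ?_)
    rw [Real.norm_eq_abs, abs_of_pos (inv_pos.2 (hp0 ω))]
    exact inv_anti₀ hη (hηp ω)
  have := integral_mul_of_condExp_eq hm ha hab h (hFm.mul hm1) hFp
  calc ∫ ω, F ω * (a ω / p ω) ∂Q = ∫ ω, (F ω * (p ω)⁻¹) * a ω ∂Q := by
        congr 1; ext ω; ring
    _ = _ := this
    _ = _ := by
        congr 1; ext ω; have := (hp0 ω).ne'; simp only [Pi.mul_apply]; field_simp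

/-- The version of `integral_div_mul_of_condExp_eq` free of integrability assumptions on `f`, needed
to prove that the imputation is square-integrable. The weighted measure and `Q` agree on `m`, so
they integrate `m`-measurable functions alike. -/
theorem lintegral_mul_of_condExp_eq (hm : m ≤ mΩ) (ha : Measurable a) (ha0 : ∀ ω, 0 ≤ a ω)
    (hab : ∀ ω, |a ω| ≤ 1)
    (h : Q[a | m] =ᵐ[Q] p) (hp : StronglyMeasurable[m] p) {η : ℝ} (hη : 0 < η)
    (hηp : ∀ ω, η ≤ p ω) {f : Ω → ℝ≥0∞} (hf : Measurable[m] f) :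
    ∫⁻ ω, f ω ∂Q = ∫⁻ ω, ENNReal.ofReal (a ω / p ω) * f ω ∂Q := by
  have hpm : Measurable p := hp.measurable.mono hm le_rfl
  have hai : Integrable a Q := (integrable_const (1 : ℝ)).mono' ha.aestronglyMeasurable
    (ae_of_all _ fun ω => hab ω)
  have hwm : Measurable fun ω => ENNReal.ofReal (a ω / p ω) := by fun_prop
  have hw0 : ∀ ω, 0 ≤ a ω / p ω := fun ω => div_nonneg (ha0 ω) (hη.le.trans (hηp ω))
  have hwi : Integrable (fun ω => a ω / p ω) Q := by
    refine (integrable_const (1 / η)).mono' (ha.div hpm).aestronglyMeasurable (ae_of_all _ fun ω => ?_)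
    rw [Real.norm_eq_abs, abs_of_nonneg (hw0 ω)]
    exact div_le_div₀ zero_le_one ((le_abs_self _).trans (hab ω)) hη (hηp ω)
  have hmeas : Q.trim hm = (Q.withDensity fun ω => ENNReal.ofReal (a ω / p ω)).trim hm := by
    refine @Measure.ext _ m _ _ fun s hs => ?_
    have hs' := hm s hs
    rw [trim_measurableSet_eq hm hs, trim_measurableSet_eq hm hs, withDensity_apply _ hs',
      ← ofReal_integral_eq_lintegral_ofReal hwi.integrableOn (ae_of_all _ hw0)]
    have := integral_div_mul_of_condExp_eq hm hai hab h hp hη hηp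
      (F := s.indicator fun _ => (1 : ℝ)) (stronglyMeasurable_const.indicator hs)
      ((integrable_const 1).indicator hs')
    rw [integral_indicator_const _ hs', smul_eq_mul, mul_one] at this
    rw [← integral_indicator hs']
    have e : ∀ ω, s.indicator (fun ω => a ω / p ω) ω
        = s.indicator (fun _ => (1 : ℝ)) ω * (a ω / p ω) := fun ω => by
      by_cases hω : ω ∈ s <;> simp [hω]
    simp_rw [e]
    rw [this, ofReal_measureReal]
  rw [← lintegral_trim hm hf, hmeas, lintegral_trim hm hf,
    lintegral_withDensity_eq_lintegral_mul _ hwm (hf.mono hm le_rfl)]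
  rfl

end InverseProbabilityWeighting

variable {E 𝓧 𝓤 𝓥 : Type*}

theorem annot_nonneg (w : Data E 𝓧 𝓤 𝓥) : 0 ≤ annot w := by unfold annot; split_ifs <;> simp

theorem abs_annot_le (w : Data E 𝓧 𝓤 𝓥) : |annot w| ≤ 1 := by unfold annot; split_ifs <;> simp

variable [MeasurableSpace E] [MeasurableSpace 𝓧] [MeasurableSpace 𝓤] [MeasurableSpace 𝓥]

theorem integrable_annot (Q : Measure (Data E 𝓧 𝓤 𝓥)) [IsFiniteMeasure Q] : Integrable annot Q :=
  integrable_boole measurable_annotated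

/-- The properties of the laws of the observed data that determine the efficient influence
function of the mean functional. -/
structure IsObservedLaw (g : E → 𝓥 → ℝ) (π : 𝓧 → ℝ) (P : Measure (Data E 𝓧 𝓤 𝓥)) : Prop where
  prob : IsProbabilityMeasure P
  condExp_annot : P[annot | MeasurableSpace.comap features inferInstance] =ᵐ[P] fun w => π (covX w)
  transformed_eq : ∀ᵐ w ∂P, annot w * transformed g w = transformed g w
  memLp : MemLp (transformed g) 2 P

omit [MeasurableSpace E] in
theorem stronglyMeasurable_score_features {π : 𝓧 → ℝ} (hπ : Measurable π) :
    StronglyMeasurable[MeasurableSpace.comap features inferInstance]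
      (fun w : Data E 𝓧 𝓤 𝓥 => π (covX w)) := by
  have hu : Measurable[MeasurableSpace.comap features inferInstance]
      (features : Data E 𝓧 𝓤 𝓥 → 𝓧 × 𝓤 × 𝓥) := comap_measurable _
  exact (hπ.comp (measurable_fst.comp hu)).stronglyMeasurable

theorem stronglyMeasurable_imputation (g : E → 𝓥 → ℝ) (P : Measure (Data E 𝓧 𝓤 𝓥)) :
    StronglyMeasurable[MeasurableSpace.comap features inferInstance] (imputation g P) :=
  stronglyMeasurable_condExp

theorem measurable_imputation (g : E → 𝓥 → ℝ) (P : Measure (Data E 𝓧 𝓤 𝓥)) :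
    Measurable (imputation g P) :=
  (stronglyMeasurable_imputation g P).measurable.mono measurable_features.comap_le le_rfl

theorem measurableSet_annotated : MeasurableSet {w : Data E 𝓧 𝓤 𝓥 | annotated w = true} :=
  measurable_annotated (measurableSet_singleton true)

theorem integral_annot_mul (P : Measure (Data E 𝓧 𝓤 𝓥)) (f : Data E 𝓧 𝓤 𝓥 → ℝ) :
    ∫ w, annot w * f w ∂P = ∫ w in {w | annotated w = true}, f w ∂P := by
  rw [← integral_indicator measurableSet_annotated]
  congr 1; ext w
  by_cases h : annotated w = true <;> simp [annot, h]

theorem restrict_eq_smul_cond (P : Measure (Data E 𝓧 𝓤 𝓥)) [IsFiniteMeasure P]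
    (S : Set (Data E 𝓧 𝓤 𝓥)) : P.restrict S = P S • cond P S := by
  by_cases h : P S = 0
  · rw [h, zero_smul, Measure.restrict_eq_zero.2 h]
  · rw [ProbabilityTheory.cond, smul_smul, ENNReal.mul_inv_cancel h (measure_ne_top _ _), one_smul]

theorem MemLp.cond {P : Measure (Data E 𝓧 𝓤 𝓥)} {f : Data E 𝓧 𝓤 𝓥 → ℝ}
    (hf : MemLp f 2 P) (S : Set (Data E 𝓧 𝓤 𝓥)) : MemLp f 2 (ProbabilityTheory.cond P S) := by
  by_cases h : P S = 0
  · rw [cond_eq_zero_of_meas_eq_zero h]; simp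
  · exact (hf.restrict S).smul_measure (ENNReal.inv_ne_top.2 h)

/-- The imputation residual is orthogonal, on the annotated data, to functions of the features. -/
theorem integral_annot_mul_residual {g : E → 𝓥 → ℝ} {P : Measure (Data E 𝓧 𝓤 𝓥)}
    [IsFiniteMeasure P] (hM : MemLp (transformed g) 2 P) {F : Data E 𝓧 𝓤 𝓥 → ℝ}
    (hFm : StronglyMeasurable[MeasurableSpace.comap features inferInstance] F)
    (hF : MemLp F 2 P) :
    ∫ w, annot w * (F w * (transformed g w - imputation g P w)) ∂P = 0 := by
  rw [integral_annot_mul, restrict_eq_smul_cond, integral_smul_measure]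
  set ν := ProbabilityTheory.cond P {w | annotated w = true} with hν
  have hMν : MemLp (transformed g) 2 ν := MemLp.cond hM _
  have hFν : MemLp F 2 ν := MemLp.cond hF _
  have hIν : MemLp (imputation g P) 2 ν := MeasureTheory.MemLp.condExp (by norm_num) hMν
  have e : ∫ w, F w * transformed g w ∂ν = ∫ w, F w * imputation g P w ∂ν := by
    rw [← integral_condExp (m := MeasurableSpace.comap features inferInstance)
      measurable_features.comap_le]
    exact integral_congr_ae (condExp_mul_of_stronglyMeasurable_left hFm
      (hFν.integrable_mul hMν) (hMν.integrable (by norm_num)))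
  have i1 : Integrable (fun w => F w * transformed g w) ν := hFν.integrable_mul hMν
  have i2 : Integrable (fun w => F w * imputation g P w) ν := hFν.integrable_mul hIν
  simp_rw [mul_sub]
  rw [integral_sub i1 i2, e, sub_self, smul_zero]

namespace IsObservedLaw

variable {g : E → 𝓥 → ℝ} {π : 𝓧 → ℝ} {P : Measure (Data E 𝓧 𝓤 𝓥)} {η : ℝ}

/-- Conditional expectation only controls `μ̃` under the law given `A = 1`. As `μ̃` depends on the
features alone, weighting gives `E[μ̃²] = E[A μ̃² / π] ≤ E[A μ̃²] / η`. -/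
theorem memLp_imputation (hP : IsObservedLaw g π P) (hπ : Measurable π) (hη : 0 < η)
    (hπ_mem : ∀ x, π x ∈ Set.Icc η 1) : MemLp (imputation g P) 2 P := by
  have := hP.prob
  have hν : MemLp (imputation g P) 2 (cond P {w | annotated w = true}) :=
    MeasureTheory.MemLp.condExp (by norm_num) (MemLp.cond hP.memLp _)
  have hS : MemLp (imputation g P) 2 (P.restrict {w | annotated w = true}) := by
    rw [restrict_eq_smul_cond]; exact hν.smul_measure (measure_ne_top _ _)
  have hm := stronglyMeasurable_imputation g P
  have hm' := measurable_imputation g P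
  refine ⟨hm'.aestronglyMeasurable, ?_⟩
  have hS2 := hS.2
  rw [eLpNorm_lt_top_iff_lintegral_rpow_enorm_lt_top (by norm_num) (by norm_num)] at hS2 ⊢
  have hfm : Measurable[MeasurableSpace.comap features inferInstance]
      fun w => ‖imputation g P w‖ₑ ^ (2 : ℝ≥0∞).toReal := 
    ((measurable_id.pow_const _).comp measurable_enorm).comp hm.measurable
  rw [lintegral_mul_of_condExp_eq measurable_features.comap_le measurable_annot annot_nonneg
    abs_annot_le hP.condExp_annot (stronglyMeasurable_score_features hπ) hη
    (fun w => (hπ_mem (covX w)).1) hfm]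
  refine lt_of_le_of_lt (b := ENNReal.ofReal (1 / η) * ∫⁻ w in {w | annotated w = true},
    ‖imputation g P w‖ₑ ^ (2 : ℝ≥0∞).toReal ∂P) ?_ (ENNReal.mul_lt_top ENNReal.ofReal_lt_top hS2)
  rw [← lintegral_const_mul _ (by fun_prop), ← lintegral_indicator measurableSet_annotated]
  refine lintegral_mono fun w => ?_
  by_cases h : annotated w = true
  · have h1 : w ∈ {w : Data E 𝓧 𝓤 𝓥 | annotated w = true} := h
    rw [Set.indicator_of_mem h1, annot, if_pos h]
    gcongr
    exact (hπ_mem _).1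
  · simp [annot, h]

/-- `E[μ̃] = E[A μ̃ / π] = E[A M̃ / π] = E[M̃ / π]`: weighting, orthogonality of the residual on
annotated data, and `A M̃ = M̃`. -/
theorem meanFunctional_eq (hP : IsObservedLaw g π P) (hπ : Measurable π) (hη : 0 < η)
    (hπ_mem : ∀ x, π x ∈ Set.Icc η 1) :
    meanFunctional g P = ∫ w, transformed g w / π (covX w) ∂P := by
  have := hP.prob
  have hI := hP.memLp_imputation hπ hη hπ_mem
  have hm := stronglyMeasurable_imputation g P
  have hπm := stronglyMeasurable_score_features (E := E) (𝓤 := 𝓤) (𝓥 := 𝓥) hπ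
  have hFm : StronglyMeasurable[MeasurableSpace.comap features inferInstance]
      fun w : Data E 𝓧 𝓤 𝓥 => (π (covX w))⁻¹ := hπm.measurable.inv.stronglyMeasurable
  have hFb : ∀ w : Data E 𝓧 𝓤 𝓥, ‖(π (covX w))⁻¹‖ ≤ η⁻¹ := fun w => by
    rw [Real.norm_eq_abs, abs_of_pos (inv_pos.2 (hη.trans_le (hπ_mem _).1))]
    exact inv_anti₀ hη (hπ_mem _).1
  have hF : MemLp (fun w : Data E 𝓧 𝓤 𝓥 => (π (covX w))⁻¹) 2 P :=
    MemLp.of_bound (hFm.mono measurable_features.comap_le).aestronglyMeasurable η⁻¹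
      (ae_of_all _ hFb)
  have h1 := integral_annot_mul_residual hP.memLp hFm hF
  have hd := integral_div_mul_of_condExp_eq measurable_features.comap_le (integrable_annot P)
    abs_annot_le hP.condExp_annot hπm hη (fun w => (hπ_mem (covX w)).1) hm
    (hI.integrable (by norm_num))
  have hA : ∀ f : Data E 𝓧 𝓤 𝓥 → ℝ, Integrable f P → Integrable (fun w => annot w * f w) P :=
    fun f hf => hf.bdd_mul measurable_annot.aestronglyMeasurable
      (ae_of_all _ fun w => (by simpa using abs_annot_le w : ‖annot w‖ ≤ 1))
  have i1 : Integrable (fun w => annot w * ((π (covX w))⁻¹ * transformed g w)) P :=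
    hA _ (hF.integrable_mul hP.memLp)
  have i2 : Integrable (fun w => annot w * ((π (covX w))⁻¹ * imputation g P w)) P :=
    hA _ (hF.integrable_mul hI)
  simp_rw [mul_sub] at h1
  rw [integral_sub i1 i2, sub_eq_zero] at h1
  calc meanFunctional g P = ∫ w, imputation g P w * (annot w / π (covX w)) ∂P := hd.symm
    _ = ∫ w, annot w * ((π (covX w))⁻¹ * imputation g P w) ∂P := by
      congr 1; ext w; ring
    _ = ∫ w, annot w * ((π (covX w))⁻¹ * transformed g w) ∂P := h1.symm
    _ = _ := by
      refine integral_congr_ae ?_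
      filter_upwards [hP.transformed_eq] with w hw
      rw [← hw]
      by_cases h : annotated w = true <;> simp [annot, h]
      field_simp

end IsObservedLaw


end MARS

end

/-! ### Observed-data laws; the AIPW function is a gradient. -/

noncomputable section

namespace MARS

variable {E 𝓧 𝓤 𝓥 : Type*}

section Features

variable [MeasurableSpace E] [MeasurableSpace 𝓧] [MeasurableSpace 𝓤] [MeasurableSpace 𝓥]

theorem comap_features_le :
    MeasurableSpace.comap (features : Data E 𝓧 𝓤 𝓥 → 𝓧 × 𝓤 × 𝓥) inferInstance ≤
      MeasurableSpace.comap unannotated inferInstance := by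
  rintro _ ⟨s, hs, rfl⟩
  exact ⟨(fun z => (z.1.1, z.1.2.1, z.2)) ⁻¹' s,
    (by fun_prop : Measurable fun z : (𝓧 × 𝓤 × E) × 𝓥 => (z.1.1, z.1.2.1, z.2)) hs, rfl⟩

theorem measurable_annot_div_and_abs_le {π : 𝓧 → ℝ} (hπ : Measurable π) {η : ℝ} (hη : 0 < η)
    (hπ_mem : ∀ x, π x ∈ Set.Icc η 1) :
    Measurable (fun w : Data E 𝓧 𝓤 𝓥 => annot w / π (covX w)) ∧
      ∀ w : Data E 𝓧 𝓤 𝓥, |annot w / π (covX w)| ≤ 1 / η := by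
  refine ⟨measurable_annot.div (hπ.comp measurable_covX), fun w => ?_⟩
  rw [abs_of_nonneg (div_nonneg (annot_nonneg w) (hη.le.trans (hπ_mem _).1))]
  exact div_le_div₀ zero_le_one ((le_abs_self _).trans (abs_annot_le w)) hη (hπ_mem _).1

theorem IsObservedLaw.memLp_aipw {g : E → 𝓥 → ℝ} {π : 𝓧 → ℝ} {P : Measure (Data E 𝓧 𝓤 𝓥)} {η : ℝ}
    (hP : IsObservedLaw g π P) (hπ : Measurable π) (hη : 0 < η)
    (hπ_mem : ∀ x, π x ∈ Set.Icc η 1) : MemLp (aipw g π P) 2 P := by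
  have := hP.prob
  have hI := hP.memLp_imputation hπ hη hπ_mem
  obtain ⟨h1, h2⟩ := measurable_annot_div_and_abs_le (E := E) (𝓤 := 𝓤) (𝓥 := 𝓥) hπ hη hπ_mem
  have h3 : MemLp (fun w => annot w / π (covX w) * (transformed g w - imputation g P w)) 2 P := by
    refine (hP.memLp.sub hI).of_le_mul (c := 1 / η)
      (h1.aestronglyMeasurable.mul (hP.memLp.sub hI).1) (ae_of_all _ fun w => ?_)
    rw [norm_mul]
    exact mul_le_mul_of_nonneg_right (h2 w) (norm_nonneg _)
  exact (hI.add h3).sub (memLp_const _)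

theorem IsObservedLaw.integral_aipw {g : E → 𝓥 → ℝ} {π : 𝓧 → ℝ} {P : Measure (Data E 𝓧 𝓤 𝓥)}
    {η : ℝ} (hP : IsObservedLaw g π P)
    (hπ : Measurable π) (hη : 0 < η) (hπ_mem : ∀ x, π x ∈ Set.Icc η 1) :
    ∫ w, aipw g π P w ∂P = 0 := by
  have := hP.prob
  have hI := (hP.memLp_imputation hπ hη hπ_mem)
  have hIi : Integrable (imputation g P) P := hI.integrable (by norm_num)
  have hMi : Integrable (transformed g) P := hP.memLp.integrable (by norm_num)
  obtain ⟨h1, h2⟩ := measurable_annot_div_and_abs_le (E := E) (𝓤 := 𝓤) (𝓥 := 𝓥) hπ hη hπ_mem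
  have iI : Integrable (fun w => imputation g P w * (annot w / π (covX w))) P :=
    hIi.mul_bdd h1.aestronglyMeasurable (ae_of_all _ h2)
  have iM : Integrable (fun w => transformed g w * (annot w / π (covX w))) P :=
    hMi.mul_bdd h1.aestronglyMeasurable (ae_of_all _ h2)
  have e1 := integral_div_mul_of_condExp_eq measurable_features.comap_le (integrable_annot P)
    abs_annot_le hP.condExp_annot (stronglyMeasurable_score_features hπ) hη
    (fun w => (hπ_mem (covX w)).1) (stronglyMeasurable_imputation g P) hIi
  have e2 : ∫ w, transformed g w * (annot w / π (covX w)) ∂P = meanFunctional g P := by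
    rw [hP.meanFunctional_eq hπ hη hπ_mem]
    refine integral_congr_ae ?_
    filter_upwards [hP.transformed_eq] with w hw
    rw [mul_div_assoc', mul_comm, hw]
  have e3 : ∀ w, aipw g π P w = (imputation g P w
      + (transformed g w * (annot w / π (covX w)) - imputation g P w * (annot w / π (covX w))))
        - meanFunctional g P := fun w => by rw [aipw]; ring
  simp_rw [e3]
  have i1 : Integrable (fun w => transformed g w * (annot w / π (covX w))
    - imputation g P w * (annot w / π (covX w))) P := iM.sub iI
  have i2 : Integrable (fun w => imputation g P w + (transformed g w * (annot w / π (covX w))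
    - imputation g P w * (annot w / π (covX w)))) P := hIi.add i1
  rw [integral_sub i2 (integrable_const _), integral_add hIi i1, integral_sub iM iI, e1, e2]
  simp

/-- The augmented inverse probability weighted score for the full data. -/
def fullDataScore (g : E → 𝓥 → ℝ) (π : 𝓧 → ℝ) (P : Measure (Data E 𝓧 𝓤 𝓥))
    (w : Data E 𝓧 𝓤 𝓥) : ℝ :=
  imputation g P w - meanFunctional g P
    + (π (covX w))⁻¹ * (transformed g w - imputation g P w)

end Features

section Observe

variable [AddCommGroup E] [Module ℝ E]

theorem observe_of_annotated {w : Data E 𝓧 𝓤 𝓥} (h : annotated w = true) : observe w = w := by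
  obtain ⟨m, a, x, u, v⟩ := w
  have : a = true := h
  subst this
  simp [observe, annot, annotated, structured, covX, unstr, ctx]

theorem observe_of_not_annotated {w : Data E 𝓧 𝓤 𝓥} (h : ¬ annotated w = true) :
    observe w = (0, false, features w) := by
  have h' : annotated w = false := by simpa using h
  simp [observe, annot, h', features]

theorem apply_zero_of_homogeneous {g : E → 𝓥 → ℝ}
    (hg_hom : ∀ c : ℝ, 0 < c → ∀ m v, g (c • m) v = c * g m v) (v : 𝓥) : g 0 v = 0 := by
  -- Homogeneity is assumed for positive factors only; the factor `2` at the origin already forces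
  -- the value zero.
  have := hg_hom 2 two_pos 0 v
  rw [smul_zero] at this
  linarith

theorem transformed_observe {g : E → 𝓥 → ℝ}
    (hg_hom : ∀ c : ℝ, 0 < c → ∀ m v, g (c • m) v = c * g m v) (w : Data E 𝓧 𝓤 𝓥) :
    transformed g (observe w) = annot w * transformed g w := by
  by_cases h : annotated w = true
  · rw [observe_of_annotated h]; simp [annot, h]
  · rw [observe_of_not_annotated h]
    simp [annot, h, transformed, structured, apply_zero_of_homogeneous hg_hom]

variable [MeasurableSpace E] [MeasurableSpace 𝓧] [MeasurableSpace 𝓤] [MeasurableSpace 𝓥]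

theorem measurable_observe : Measurable (observe : Data E 𝓧 𝓤 𝓥 → Data E 𝓧 𝓤 𝓥) := by
  have h : (observe : Data E 𝓧 𝓤 𝓥 → Data E 𝓧 𝓤 𝓥)
      = fun w => if annotated w = true then w else (0, false, features w) := by
    ext1 w
    split_ifs with h
    exacts [observe_of_annotated h, observe_of_not_annotated h]
  rw [h]
  have := measurable_features (E := E) (𝓧 := 𝓧) (𝓤 := 𝓤) (𝓥 := 𝓥)
  exact Measurable.ite measurableSet_annotated measurable_id (by fun_prop)

omit [MeasurableSpace E] in
theorem apply_observe_of_features {F : Data E 𝓧 𝓤 𝓥 → ℝ}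
    (hF : StronglyMeasurable[MeasurableSpace.comap features inferInstance] F)
    (w : Data E 𝓧 𝓤 𝓥) : F (observe w) = F w := by
  obtain ⟨f, -, rfl⟩ := hF.measurable.exists_eq_measurable_comp
  rfl

theorem lintegral_transformed_observe_le {g : E → 𝓥 → ℝ} (hg : Measurable (Function.uncurry g))
    (hg_hom : ∀ c : ℝ, 0 < c → ∀ m v, g (c • m) v = c * g m v) (Q : Measure (Data E 𝓧 𝓤 𝓥)) :
    ∫⁻ w, ENNReal.ofReal (transformed g w ^ 2) ∂(Q.map observe)
      ≤ ∫⁻ w, ENNReal.ofReal (transformed g w ^ 2) ∂Q := by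
  have hm := measurable_transformed (𝓧 := 𝓧) (𝓤 := 𝓤) hg
  rw [lintegral_map (by fun_prop) measurable_observe]
  refine lintegral_mono fun w => ENNReal.ofReal_le_ofReal ?_
  rw [transformed_observe hg_hom, mul_pow]
  have h1 : annot w ^ 2 ≤ 1 := by
    rw [← sq_abs]; exact pow_le_one₀ (abs_nonneg _) (abs_annot_le w)
  nlinarith [sq_nonneg (transformed g w)]

theorem fullDataScore_sub_aipw_observe {g : E → 𝓥 → ℝ} {π : 𝓧 → ℝ}
    (hg_hom : ∀ c : ℝ, 0 < c → ∀ m v, g (c • m) v = c * g m v)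
    (P : Measure (Data E 𝓧 𝓤 𝓥)) (w : Data E 𝓧 𝓤 𝓥) :
    fullDataScore g π P w - aipw g π P (observe w) =
      (π (covX w))⁻¹ * (transformed g w - imputation g P w)
        - (π (covX w))⁻¹ * (transformed g w - imputation g P w) * annot w := by
  have h1 := apply_observe_of_features (stronglyMeasurable_imputation g P) w
  have h2 : annot (observe w) = annot w := rfl
  have h3 : covX (observe w) = covX w := rfl
  rw [fullDataScore, aipw, h1, h2, h3, transformed_observe hg_hom]
  unfold annot
  split_ifs
  · ring
  · ring

variable [StandardBorelSpace E] [StandardBorelSpace 𝓧] [StandardBorelSpace 𝓤]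
  [StandardBorelSpace 𝓥] {𝓜 : Set E} {g : E → 𝓥 → ℝ} {π : 𝓧 → ℝ} {η : ℝ}
  {P : Measure (Data E 𝓧 𝓤 𝓥)}

/-- Observation leaves `A` and `X̃` untouched, so `E[A | X̃] = π(X)` passes from the full-data law
to its image. -/
theorem isObservedLaw_of_mem_model (hg : Measurable (Function.uncurry g))
    (hg_hom : ∀ c : ℝ, 0 < c → ∀ m v, g (c • m) v = c * g m v) (hπ : Measurable π) (hη : 0 < η)
    (hπ_mem : ∀ x, π x ∈ Set.Icc η 1) (hP : P ∈ model 𝓜 g π) : IsObservedLaw g π P := by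
  obtain ⟨Q, hQp, hQ, rfl⟩ := hP
  have hobs : AEMeasurable (observe : Data E 𝓧 𝓤 𝓥 → _) Q := measurable_observe.aemeasurable
  have hprob : IsProbabilityMeasure (Q.map observe) := Measure.isProbabilityMeasure_map hobs
  have hm := measurable_transformed (𝓧 := 𝓧) (𝓤 := 𝓤) hg
  refine ⟨hprob, ?_, ?_, ?_⟩
  · have hQf := condExp_of_le_of_stronglyMeasurable comap_features_le
      measurable_unannotated.comap_le (stronglyMeasurable_score_features hπ)
      (integrable_score hπ hη hπ_mem Q) hQ.condExp_annot
    refine (ae_eq_condExp_of_forall_setIntegral_eq measurable_features.comap_le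
      (integrable_annot _) (fun _ _ _ => (integrable_score hπ hη hπ_mem _).integrableOn) ?_
      (stronglyMeasurable_score_features hπ).aestronglyMeasurable).symm
    rintro S hS -
    have hS' := measurable_features.comap_le _ hS
    have hpre : observe ⁻¹' S = S := by
      obtain ⟨s, -, rfl⟩ := hS
      rfl
    rw [setIntegral_map (f := fun w => π (covX w)) hS' (hπ.comp measurable_covX).aestronglyMeasurable hobs,
      setIntegral_map hS' measurable_annot.aestronglyMeasurable hobs, hpre]
    calc ∫ w in S, π (covX w) ∂Q = ∫ w in S, (Q[annot | MeasurableSpace.comap features inferInstance]) w ∂Q :=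
          setIntegral_congr_ae hS' (hQf.mono fun w hw _ => hw.symm)
      _ = ∫ w in S, annot w ∂Q :=
          setIntegral_condExp measurable_features.comap_le (integrable_annot Q) hS
  · rw [ae_map_iff (p := fun w => annot w * transformed g w = transformed g w) hobs
      (measurableSet_eq_fun (measurable_annot.mul hm) hm)]
    refine ae_of_all _ fun w => ?_
    have : annot (observe w) = annot w := rfl
    rw [this, transformed_observe hg_hom]
    unfold annot; split_ifs <;> simp
  · have h2 := hQ.memLp.integrable_sq.2
    rw [hasFiniteIntegral_iff_ofReal (ae_of_all _ fun _ => sq_nonneg _)] at h2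
    rw [memLp_two_iff_integrable_sq hm.aestronglyMeasurable]
    refine ⟨by fun_prop, ?_⟩
    rw [hasFiniteIntegral_iff_ofReal (ae_of_all _ fun _ => sq_nonneg _)]
    exact (lintegral_transformed_observe_le hg hg_hom Q).trans_lt h2

theorem eventually_of_mem_paths {γ : ℝ → Measure (Data E 𝓧 𝓤 𝓥)} (hγ : γ ∈ paths 𝓜 g π P) :
    ∃ C : ℝ≥0, (P ∈ model 𝓜 g π ∧ ∫⁻ w, ENNReal.ofReal (transformed g w ^ 2) ∂P ≤ C) ∧
      ∀ᶠ t in 𝓝[>] (0 : ℝ),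
        γ t ∈ model 𝓜 g π ∧ ∫⁻ w, ENNReal.ofReal (transformed g w ^ 2) ∂(γ t) ≤ C := by
  obtain ⟨h0, ε, hε, C, hC⟩ := hγ
  refine ⟨C, h0 ▸ hC 0 ⟨le_rfl, hε⟩, ?_⟩
  filter_upwards [Ioo_mem_nhdsGT hε] with t ht
  exact hC t ⟨ht.1.le, ht.2⟩

open Semiparametric

/-- The weight has expectation `c` under every law of the model, so its derivative along the path is
zero; boundedness of `F` supplies the uniform second moment that differentiation requires. -/
theorem integral_weight_mul_score_of_bounded (hg : Measurable (Function.uncurry g))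
    (hg_hom : ∀ c : ℝ, 0 < c → ∀ m v, g (c • m) v = c * g m v) (hπ : Measurable π) (hη : 0 < η)
    (hπ_mem : ∀ x, π x ∈ Set.Icc η 1) {γ : ℝ → Measure (Data E 𝓧 𝓤 𝓥)}
    (hγ : γ ∈ paths 𝓜 g π P) {h : Data E 𝓧 𝓤 𝓥 → ℝ} (hs : HasScore P γ h)
    {F : Data E 𝓧 𝓤 𝓥 → ℝ}
    (hF : StronglyMeasurable[MeasurableSpace.comap features inferInstance] F) {B : ℝ}
    (hB : ∀ w, |F w| ≤ B) (c : ℝ) :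
    ∫ w, (F w * (annot w / π (covX w)) - F w + c) * h w ∂P = 0 := by
  obtain ⟨C, ⟨hP, -⟩, hev⟩ := eventually_of_mem_paths hγ
  have hobs := fun {ν : Measure (Data E 𝓧 𝓤 𝓥)} (hR : ν ∈ model 𝓜 g π) =>
    isObservedLaw_of_mem_model hg hg_hom hπ hη hπ_mem hR
  obtain ⟨h1, h2⟩ := measurable_annot_div_and_abs_le (E := E) (𝓤 := 𝓤) (𝓥 := 𝓥) hπ hη hπ_mem
  have hFm : Measurable F := hF.measurable.mono measurable_features.comap_le le_rfl
  have hψm : Measurable fun w => F w * (annot w / π (covX w)) - F w + c :=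
    ((hFm.mul h1).sub hFm).add_const c
  have hK : ∀ w, |F w * (annot w / π (covX w)) - F w + c| ≤ B * (1 / η) + B + |c| := fun w => by
    have hB0 : 0 ≤ B := (abs_nonneg _).trans (hB w)
    refine (abs_add_le _ _).trans (add_le_add_left ((abs_sub _ _).trans (add_le_add ?_ (hB w))) _)
    rw [abs_mul]
    exact mul_le_mul (hB w) (h2 w) (abs_nonneg _) hB0
  have hmean : ∀ ν ∈ model 𝓜 g π, ∫ w, (F w * (annot w / π (covX w)) - F w + c) ∂ν = c := by
    intro ν hR
    have hR' := hobs hR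
    have := hR'.prob
    have iF : Integrable F ν :=
      (integrable_const B).mono' hFm.aestronglyMeasurable (ae_of_all _ hB)
    have iFa : Integrable (fun w => F w * (annot w / π (covX w))) ν :=
      iF.mul_bdd h1.aestronglyMeasurable (ae_of_all _ h2)
    have e := integral_div_mul_of_condExp_eq measurable_features.comap_le (integrable_annot ν)
      abs_annot_le hR'.condExp_annot (stronglyMeasurable_score_features hπ) hη
      (fun w => (hπ_mem (covX w)).1) hF iF
    rw [integral_add (f := fun w => F w * (annot w / π (covX w)) - F w) (iFa.sub iF)
      (integrable_const c), integral_sub iFa iF, e]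
    simp
  have hbd : ∀ ν ∈ model 𝓜 g π, ∫⁻ w, ENNReal.ofReal
      ((F w * (annot w / π (covX w)) - F w + c) ^ 2) ∂ν
        ≤ ((B * (1 / η) + B + |c|) ^ 2).toNNReal := by
    intro ν hR
    have := (hobs hR).prob
    calc _ ≤ ∫⁻ _, ENNReal.ofReal ((B * (1 / η) + B + |c|) ^ 2) ∂ν := by
          refine lintegral_mono fun w => ENNReal.ofReal_le_ofReal ?_
          rw [← sq_abs]
          exact pow_le_pow_left₀ (abs_nonneg _) (hK w) 2
      _ = _ := by simp [ENNReal.ofReal]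
  have hPp := (hobs hP).prob
  have hlim := hs.tendsto_integral hψm (hbd P hP) (hev.mono fun t ht =>
    ⟨have := (hobs ht.1).prob; inferInstance, hbd _ ht.1⟩)
  refine tendsto_nhds_unique hlim (tendsto_const_nhds.congr' ?_)
  filter_upwards [hev] with t ht
  rw [hmean _ ht.1, hmean _ hP]
  simp

/-- The imputation is square-integrable under `P`, but its second moment is not controlled along the
path, hence the passage through truncations. -/
theorem integral_weight_mul_score (hg : Measurable (Function.uncurry g))
    (hg_hom : ∀ c : ℝ, 0 < c → ∀ m v, g (c • m) v = c * g m v) (hπ : Measurable π) (hη : 0 < η)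
    (hπ_mem : ∀ x, π x ∈ Set.Icc η 1) {γ : ℝ → Measure (Data E 𝓧 𝓤 𝓥)}
    (hγ : γ ∈ paths 𝓜 g π P) {h : Data E 𝓧 𝓤 𝓥 → ℝ} (hs : HasScore P γ h)
    {F : Data E 𝓧 𝓤 𝓥 → ℝ}
    (hF : StronglyMeasurable[MeasurableSpace.comap features inferInstance] F)
    (hF2 : MemLp F 2 P) (c : ℝ) :
    ∫ w, (F w * (annot w / π (covX w)) - F w + c) * h w ∂P = 0 := by
  obtain ⟨C, ⟨hP, -⟩, hev⟩ := eventually_of_mem_paths hγ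
  have := (isObservedLaw_of_mem_model hg hg_hom hπ hη hπ_mem hP).prob
  obtain ⟨h1, h2⟩ := measurable_annot_div_and_abs_le (E := E) (𝓤 := 𝓤) (𝓥 := 𝓥) hπ hη hπ_mem
  have hFm : Measurable F := hF.measurable.mono measurable_features.comap_le le_rfl
  -- The case `F = 0`: scores have mean zero, up to the factor `c`.
  have hc0 := integral_weight_mul_score_of_bounded hg hg_hom hπ hη hπ_mem hγ hs
    (F := fun _ => 0) stronglyMeasurable_const (B := 0) (fun _ => by simp) c
  simp only [zero_mul, sub_zero, zero_add] at hc0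
  have hh : Integrable h P := hs.1.integrable (by norm_num)
  have iFh : Integrable (fun w => F w * h w) P := hF2.integrable_mul hs.1
  have iG : Integrable (fun w => (F w * (annot w / π (covX w)) - F w) * h w) P := by
    have : Integrable (fun w => (annot w / π (covX w)) * (F w * h w) - F w * h w) P :=
      (iFh.bdd_mul h1.aestronglyMeasurable (ae_of_all _ h2)).sub iFh
    refine this.congr (ae_of_all _ fun w => by ring)
  have htail := tendsto_integral_tail hFm iG
  -- The part with `|F| ≤ n` contributes zero by the bounded case, so the tail integral equals the
  -- full integral for every `n`, while it tends to zero.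
  have hzero : ∀ n : ℕ, ∫ w, (if (n : ℝ) < |F w| then
      (F w * (annot w / π (covX w)) - F w) * h w else 0) ∂P
        = ∫ w, (F w * (annot w / π (covX w)) - F w) * h w ∂P := by
    intro n
    have hSm : MeasurableSet[MeasurableSpace.comap features inferInstance]
        {w | (n : ℝ) < |F w|} :=
      hF.measurable ((measurableSet_lt measurable_const measurable_abs :
        MeasurableSet {x : ℝ | (n : ℝ) < |x|}))
    have hSm' := measurable_features.comap_le _ hSm
    have hb := integral_weight_mul_score_of_bounded hg hg_hom hπ hη hπ_mem hγ hs
      (F := {w | (n : ℝ) < |F w|}ᶜ.indicator F) (hF.indicator hSm.compl) (B := n) (fun w => by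
        by_cases hw : (n : ℝ) < |F w|
        · simp [Set.indicator, hw]
        · simp only [Set.indicator, Set.mem_compl_iff, Set.mem_ofPred_eq, hw, not_false_eq_true,
            if_true]
          exact not_lt.1 hw) 0
    have iT : Integrable (fun w => if (n : ℝ) < |F w| then
      (F w * (annot w / π (covX w)) - F w) * h w else 0) P := iG.indicator hSm'
    rw [eq_comm, ← sub_eq_zero, ← integral_sub iG iT]
    refine Eq.trans ?_ hb
    congr 1; ext w
    by_cases hw : (n : ℝ) < |F w| <;> simp [Set.indicator, hw]
  simp_rw [hzero] at htail
  have h0 := tendsto_nhds_unique htail tendsto_const_nhds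
  simp_rw [add_mul]
  rw [integral_add iG (hh.const_mul c), ← h0, hc0, add_zero]

theorem isInfluenceFunction_aipw (hg : Measurable (Function.uncurry g))
    (hg_hom : ∀ c : ℝ, 0 < c → ∀ m v, g (c • m) v = c * g m v) (hπ : Measurable π) (hη : 0 < η)
    (hπ_mem : ∀ x, π x ∈ Set.Icc η 1) (hP : P ∈ model 𝓜 g π) :
    IsInfluenceFunction P (paths 𝓜 g π P) (meanFunctional g) (aipw g π P) := by
  have hobs := fun {ν : Measure (Data E 𝓧 𝓤 𝓥)} (hR : ν ∈ model 𝓜 g π) =>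
    isObservedLaw_of_mem_model hg hg_hom hπ hη hπ_mem hR
  have hP' := hobs hP
  have hPp := hP'.prob
  refine ⟨hP'.memLp_aipw hπ hη hπ_mem, fun γ hγ h hs => ?_⟩
  obtain ⟨C, ⟨-, hPC⟩, hev⟩ := eventually_of_mem_paths hγ
  have hψm : Measurable fun w : Data E 𝓧 𝓤 𝓥 => transformed g w / π (covX w) :=
    (measurable_transformed hg).div (hπ.comp measurable_covX)
  have hbd : ∀ ν : Measure (Data E 𝓧 𝓤 𝓥),
      ∫⁻ w, ENNReal.ofReal (transformed g w ^ 2) ∂ν ≤ C →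
      ∫⁻ w, ENNReal.ofReal ((transformed g w / π (covX w)) ^ 2) ∂ν
        ≤ ((1 / η ^ 2).toNNReal * C : ℝ≥0) := by
    intro ν hR
    calc _ ≤ ∫⁻ w, ENNReal.ofReal (1 / η ^ 2) * ENNReal.ofReal (transformed g w ^ 2) ∂ν := by
          refine lintegral_mono fun w => ?_
          rw [← ENNReal.ofReal_mul (by positivity)]
          refine ENNReal.ofReal_le_ofReal ?_
          rw [div_pow, div_eq_mul_one_div, mul_comm]
          refine mul_le_mul_of_nonneg_right ?_ (sq_nonneg _)
          have := (hπ_mem (covX w)).1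
          gcongr
      _ = ENNReal.ofReal (1 / η ^ 2) * ∫⁻ w, ENNReal.ofReal (transformed g w ^ 2) ∂ν :=
          lintegral_const_mul' _ _ ENNReal.ofReal_ne_top
      _ ≤ _ := by
          rw [ENNReal.coe_mul]
          exact mul_le_mul' le_rfl hR
  have hlim := hs.tendsto_integral hψm (hbd P hPC) (hev.mono fun t ht =>
    ⟨have := (hobs ht.1).prob; inferInstance, hbd _ ht.2⟩)
  have hI := hP'.memLp_imputation hπ hη hπ_mem
  have hw := integral_weight_mul_score hg hg_hom hπ hη hπ_mem hγ hs
    (stronglyMeasurable_imputation g P) hI (meanFunctional g P)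
  have iψ : Integrable (fun w => transformed g w / π (covX w) * h w) P :=
    (memLp_two_of_lintegral_le hψm (hbd P hPC)).1.integrable_mul hs.1
  have iφ : Integrable (fun w => aipw g π P w * h w) P :=
    (hP'.memLp_aipw hπ hη hπ_mem).integrable_mul hs.1
  have e : ∫ w, aipw g π P w * h w ∂P = ∫ w, transformed g w / π (covX w) * h w ∂P := by
    rw [eq_comm, ← sub_eq_zero, ← integral_sub iψ iφ, ← hw]
    refine integral_congr_ae ?_
    filter_upwards [hP'.transformed_eq] with w hw
    have : transformed g w / π (covX w) = annot w / π (covX w) * transformed g w := by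
      rw [div_mul_eq_mul_div, hw]
    rw [this, aipw]
    ring
  rw [e]
  refine hlim.congr' ?_
  filter_upwards [hev] with t ht
  rw [(hobs ht.1).meanFunctional_eq hπ hη hπ_mem, hP'.meanFunctional_eq hπ hη hπ_mem]

end Observe

end MARS

end

/-! ### The AIPW function lies in the tangent space. -/

noncomputable section

namespace MARS

/-- The density of an image measure is the conditional expectation of the density. -/
theorem map_withDensity_of_condExp {Ω Ω' : Type*} [mΩ : MeasurableSpace Ω] [mΩ' : MeasurableSpace Ω']
    {Q : Measure Ω} [IsFiniteMeasure Q] {f : Ω → Ω'} (hf : Measurable f) {D : Ω → ℝ} {K : Ω' → ℝ}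
    (hD : Integrable D Q) (hD0 : ∀ ω, 0 ≤ D ω) (hK : Measurable K) (hK0 : ∀ ω, 0 ≤ K ω)
    (hDK : K ∘ f =ᵐ[Q] Q[D | mΩ'.comap f]) :
    (Q.withDensity fun ω => ENNReal.ofReal (D ω)).map f
      = (Q.map f).withDensity fun ω => ENNReal.ofReal (K ω) := by
  ext s hs
  have hs' := hf hs
  have hKi : Integrable (K ∘ f) Q := integrable_condExp.congr hDK.symm
  rw [Measure.map_apply hf hs, withDensity_apply _ hs', withDensity_apply _ hs,
    setLIntegral_map hs (by fun_prop) hf,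
    ← ofReal_integral_eq_lintegral_ofReal hD.integrableOn (ae_of_all _ hD0),
    ← ofReal_integral_eq_lintegral_ofReal (f := fun ω => K (f ω)) hKi.integrableOn
      (ae_of_all _ fun ω => hK0 (f ω)),
    ← setIntegral_condExp hf.comap_le hD ⟨s, hs, rfl⟩]
  congr 1
  exact setIntegral_congr_ae hs' (hDK.mono fun ω hω _ => hω.symm)

theorem lintegral_withDensity_le_two_mul {Ω : Type*} [MeasurableSpace Ω] {Q : Measure Ω}
    {D : Ω → ℝ} (hD : Measurable D) (hD2 : ∀ w, D w ≤ 2) {f : Ω → ℝ≥0∞} (hf : Measurable f) :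
    ∫⁻ w, f w ∂(Q.withDensity fun w => ENNReal.ofReal (D w)) ≤ 2 * ∫⁻ w, f w ∂Q := by
  rw [lintegral_withDensity_eq_lintegral_mul _ (by fun_prop) hf, ← lintegral_const_mul _ hf]
  refine lintegral_mono fun w => ?_
  rw [Pi.mul_apply]
  gcongr
  exact ENNReal.ofReal_le_of_le_toReal (by simpa using hD2 w)

variable {E 𝓧 𝓤 𝓥 : Type*} [MeasurableSpace E] [MeasurableSpace 𝓧] [MeasurableSpace 𝓤]
  [MeasurableSpace 𝓥]

variable [StandardBorelSpace E] [StandardBorelSpace 𝓧] [StandardBorelSpace 𝓤]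
  [StandardBorelSpace 𝓥] {𝓜 : Set E} {g : E → 𝓥 → ℝ} {π : 𝓧 → ℝ} {η : ℝ}

/-- Reweighting a full-data law by a density that does not depend on the annotation indicator
yields a full-data law. -/
theorem IsFullDataLaw.withDensity {Q : Measure (Data E 𝓧 𝓤 𝓥)} [IsProbabilityMeasure Q]
    (hQ : IsFullDataLaw 𝓜 g π Q) (hg : Measurable (Function.uncurry g))
    (hπ : Measurable π) (hη : 0 < η) (hπ_mem : ∀ x, π x ∈ Set.Icc η 1) {D : Data E 𝓧 𝓤 𝓥 → ℝ}
    (hD : StronglyMeasurable[MeasurableSpace.comap unannotated inferInstance] D)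
    (hD0 : ∀ w, 0 ≤ D w) (hD2 : ∀ w, D w ≤ 2) (hD1 : ∫ w, D w ∂Q = 1) :
    ∃ _ : IsProbabilityMeasure (Q.withDensity fun w => ENNReal.ofReal (D w)),
      IsFullDataLaw 𝓜 g π (Q.withDensity fun w => ENNReal.ofReal (D w)) := by
  have hDm : Measurable D := hD.measurable.mono measurable_unannotated.comap_le le_rfl
  have hDm' : Measurable fun w => ENNReal.ofReal (D w) := by fun_prop
  have hDi : Integrable D Q := by
    by_contra h
    rw [integral_undef h] at hD1
    exact zero_ne_one hD1
  have hm := measurable_transformed (𝓧 := 𝓧) (𝓤 := 𝓤) hg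
  have hprob : IsProbabilityMeasure (Q.withDensity fun w => ENNReal.ofReal (D w)) := by
    constructor
    rw [withDensity_apply _ MeasurableSet.univ, Measure.restrict_univ,
      ← ofReal_integral_eq_lintegral_ofReal hDi (ae_of_all _ hD0), hD1, ENNReal.ofReal_one]
  refine ⟨hprob, isFullDataLaw_of_condExp_annot hπ (integrable_score hπ hη hπ_mem _)
    ((withDensity_absolutelyContinuous Q _).ae_le hQ.mem_range) ?_ ?_⟩
  · have h2 := hQ.memLp.integrable_sq.2
    rw [hasFiniteIntegral_iff_ofReal (ae_of_all _ fun _ => sq_nonneg _)] at h2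
    rw [memLp_two_iff_integrable_sq hm.aestronglyMeasurable]
    refine ⟨by fun_prop, ?_⟩
    rw [hasFiniteIntegral_iff_ofReal (ae_of_all _ fun _ => sq_nonneg _)]
    exact (lintegral_withDensity_le_two_mul hDm hD2 (by fun_prop)).trans_lt
      (ENNReal.mul_lt_top (by simp) h2)
  · refine (ae_eq_condExp_of_forall_setIntegral_eq measurable_unannotated.comap_le
      (integrable_annot _) (fun _ _ _ => (integrable_score hπ hη hπ_mem _).integrableOn) ?_
      ((stronglyMeasurable_score_features hπ).mono comap_features_le).aestronglyMeasurable).symm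
    rintro S hS -
    have hS' := measurable_unannotated.comap_le _ hS
    have hdens : ∀ f : Data E 𝓧 𝓤 𝓥 → ℝ,
        ∫ w in S, f w ∂(Q.withDensity fun w => ENNReal.ofReal (D w))
          = ∫ w, S.indicator D w * f w ∂Q := fun f => by
      rw [setIntegral_withDensity_eq_setIntegral_toReal_smul hDm' (ae_of_all _ fun w =>
        ENNReal.ofReal_lt_top) _ hS', ← integral_indicator hS']
      congr 1; ext w
      by_cases hw : w ∈ S <;> simp [hw, ENNReal.toReal_ofReal (hD0 w)]
    -- `D` restricted to `S` does not involve `A`, so it may multiply the identity `E_Q[A | X, U,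
    -- M*, V] = π(X)`.
    rw [hdens, hdens]
    exact (integral_mul_of_condExp_eq measurable_unannotated.comap_le (integrable_annot Q)
      abs_annot_le hQ.condExp_annot (hD.indicator hS) (hDi.indicator hS')).symm

open Semiparametric

variable [AddCommGroup E] [Module ℝ E]

/-- Every bounded centred function of the full data without the annotation indicator yields a
score of the observed-data model: its conditional expectation given the observed data. -/
theorem exists_path_of_bounded {Q : Measure (Data E 𝓧 𝓤 𝓥)} [IsProbabilityMeasure Q]
    (hQ : IsFullDataLaw 𝓜 g π Q) (hg : Measurable (Function.uncurry g))
    (hg_hom : ∀ c : ℝ, 0 < c → ∀ m v, g (c • m) v = c * g m v)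
    (hπ : Measurable π) (hη : 0 < η) (hπ_mem : ∀ x, π x ∈ Set.Icc η 1) {H : Data E 𝓧 𝓤 𝓥 → ℝ}
    (hH : StronglyMeasurable[MeasurableSpace.comap unannotated inferInstance] H)
    {B : ℝ} (hB0 : 0 ≤ B) (hB : ∀ w, |H w| ≤ B) (hH0 : ∫ w, H w ∂Q = 0) :
    ∃ k : Data E 𝓧 𝓤 𝓥 → ℝ, k ∘ observe =ᵐ[Q] Q[H | MeasurableSpace.comap observe inferInstance] ∧
      ∃ γ ∈ paths 𝓜 g π (Q.map observe), HasScore (Q.map observe) γ k := by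
  have hobs : Measurable (observe : Data E 𝓧 𝓤 𝓥 → _) := measurable_observe
  have hHm : Measurable H := hH.measurable.mono measurable_unannotated.comap_le le_rfl
  have hm := measurable_transformed (𝓧 := 𝓧) (𝓤 := 𝓤) hg
  have hHi : Integrable H Q :=
    (integrable_const B).mono' hHm.aestronglyMeasurable (ae_of_all _ hB)
  obtain ⟨k₀, hk₀, hk₀e⟩ := (stronglyMeasurable_condExp (f := H) (μ := Q)
    (m := MeasurableSpace.comap (observe : Data E 𝓧 𝓤 𝓥 → _)
      inferInstance)).measurable.exists_eq_measurable_comp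
  have hbd := ae_bdd_abs_condExp_of_ae_bdd_abs (m := MeasurableSpace.comap
    (observe : Data E 𝓧 𝓤 𝓥 → _) inferInstance) (ae_of_all Q hB)
  -- The conditional expectation is bounded by `B` only almost everywhere; clipping yields a version
  -- bounded everywhere.
  set k : Data E 𝓧 𝓤 𝓥 → ℝ := fun w => max (-B) (min B (k₀ w)) with hk
  have hkm : Measurable k := by fun_prop
  have hkB : ∀ w, |k w| ≤ B := fun w =>
    abs_le.2 ⟨le_max_left _ _, max_le (by linarith) (min_le_left _ _)⟩
  have hke : k ∘ observe =ᵐ[Q] Q[H | MeasurableSpace.comap observe inferInstance] := by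
    filter_upwards [hbd] with w hw
    rw [hk₀e] at hw ⊢
    obtain ⟨h1, h2⟩ := abs_le.1 hw
    simp only [Function.comp_apply] at h1 h2
    simp [hk, h1, h2]
  refine ⟨k, hke, fun t => (Q.withDensity fun w => ENNReal.ofReal (1 + t * H w)).map observe,
    ⟨by simp, ?_⟩, ?_⟩
  · have h2 := hQ.memLp.integrable_sq.2
    rw [hasFiniteIntegral_iff_ofReal (ae_of_all _ fun _ => sq_nonneg _)] at h2
    obtain ⟨C, hC⟩ := WithTop.ne_top_iff_exists.1
      (ENNReal.mul_lt_top (a := 2) (by simp) h2).ne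
    -- For `t < 1 / (B + 1)` the density `1 + t H` stays in `[0, 2]`, whence the constant `C`, twice
    -- the second moment under `Q`; adding one to `B` allows `B = 0`.
    refine ⟨1 / (B + 1), by positivity, C, fun t ht => ?_⟩
    have htB : t * B ≤ 1 := by
      have := (le_div_iff₀ (by linarith : 0 < B + 1)).1 ht.2.le
      nlinarith [ht.1]
    have hsmall : ∀ w, |t * H w| ≤ 1 := fun w => by
      rw [abs_mul, abs_of_nonneg ht.1]
      exact (mul_le_mul_of_nonneg_left (hB w) ht.1).trans htB
    have hD2 : ∀ w, 1 + t * H w ≤ 2 := fun w => by linarith [(abs_le.1 (hsmall w)).2]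
    obtain ⟨hp, hfull⟩ := hQ.withDensity hg hπ hη hπ_mem (D := fun w => 1 + t * H w)
      (stronglyMeasurable_const.add (hH.const_mul t))
      (fun w => by linarith [(abs_le.1 (hsmall w)).1]) hD2 (by
        rw [integral_add (integrable_const _) (hHi.const_mul t), integral_const_mul, hH0]; simp)
    refine ⟨⟨_, hp, hfull, rfl⟩, ?_⟩
    refine le_of_le_of_eq ?_ hC.symm
    exact (lintegral_transformed_observe_le hg hg_hom _).trans
      (lintegral_withDensity_le_two_mul (by fun_prop) hD2 (by fun_prop))
  · have := Measure.isProbabilityMeasure_map (μ := Q) hobs.aemeasurable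
    refine hasScore_withDensity hkm hkB ?_
    have ht0 : Tendsto (fun t : ℝ => t) (𝓝[>] 0) (𝓝 0) := nhdsWithin_le_nhds
    have hlt := ht0.mul_const B
    rw [zero_mul] at hlt
    filter_upwards [hlt.eventually_lt_const one_pos, self_mem_nhdsWithin] with t htB htpos
    have htpos : 0 < t := htpos
    have hnn : ∀ x, |x| ≤ B → 0 ≤ 1 + t * x := fun x hx => by
      have := abs_le.1 hx
      nlinarith
    refine map_withDensity_of_condExp hobs ((integrable_const 1).add (hHi.const_mul t))
      (fun w => hnn _ (hB w)) (by fun_prop) (fun w => hnn _ (hkB w)) ?_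
    have h1 := condExp_add (integrable_const (μ := Q) (1 : ℝ)) (hHi.smul t)
      (MeasurableSpace.comap observe inferInstance)
    have h2 := condExp_smul (μ := Q) t H (MeasurableSpace.comap observe inferInstance)
    rw [condExp_const hobs.comap_le] at h1
    filter_upwards [h1, h2, hke] with w h1 h2 h3
    refine Eq.trans ?_ h1.symm
    rw [Pi.add_apply, h2, Pi.smul_apply, ← h3]
    rfl

/-- By `fullDataScore_sub_aipw_observe` the difference is `G (1 - A)`, with `G` the residual divided
by `π`. It lives on `A = 0`, where only the features are observed, so it suffices to integrate it
over feature events. -/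
theorem condExp_fullDataScore {Q : Measure (Data E 𝓧 𝓤 𝓥)} [IsProbabilityMeasure Q]
    (hQ : IsFullDataLaw 𝓜 g π Q) (hg : Measurable (Function.uncurry g))
    (hg_hom : ∀ c : ℝ, 0 < c → ∀ m v, g (c • m) v = c * g m v)
    (hπ : Measurable π) (hη : 0 < η) (hπ_mem : ∀ x, π x ∈ Set.Icc η 1) :
    (StronglyMeasurable[MeasurableSpace.comap unannotated inferInstance]
        (fullDataScore g π (Q.map observe)) ∧
      MemLp (fullDataScore g π (Q.map observe)) 2 Q) ∧
    aipw g π (Q.map observe) ∘ observe =ᵐ[Q]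
      Q[fullDataScore g π (Q.map observe) | MeasurableSpace.comap observe inferInstance] := by
  have hobs : Measurable (observe : Data E 𝓧 𝓤 𝓥 → _) := measurable_observe
  have hP := isObservedLaw_of_mem_model hg hg_hom hπ hη hπ_mem ⟨Q, ‹_›, hQ, rfl⟩
  set P := Q.map observe with hPdef
  have := hP.prob
  have hm := measurable_transformed (𝓧 := 𝓧) (𝓤 := 𝓤) hg
  have hIs := stronglyMeasurable_imputation g P
  have hIm := measurable_imputation g P
  have hI : MemLp (imputation g P) 2 Q := by
    have := (memLp_map_measure_iff hIm.aestronglyMeasurable hobs.aemeasurable).1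
      (hP.memLp_imputation hπ hη hπ_mem)
    have e : imputation g P ∘ observe = imputation g P :=
      funext fun w => apply_observe_of_features hIs w
    rwa [e] at this
  have hπs := stronglyMeasurable_score_features (E := E) (𝓤 := 𝓤) (𝓥 := 𝓥) hπ
  have hinv : StronglyMeasurable[MeasurableSpace.comap features inferInstance]
      fun w : Data E 𝓧 𝓤 𝓥 => (π (covX w))⁻¹ := hπs.measurable.inv.stronglyMeasurable
  have hinvm := hinv.mono measurable_features.comap_le
  have hpos : ∀ w : Data E 𝓧 𝓤 𝓥, 0 < π (covX w) := fun w => hη.trans_le (hπ_mem _).1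
  have hinvb : ∀ w : Data E 𝓧 𝓤 𝓥, ‖(π (covX w))⁻¹‖ ≤ η⁻¹ := fun w => by
    rw [Real.norm_eq_abs, abs_of_pos (inv_pos.2 (hpos w))]
    exact inv_anti₀ hη (hπ_mem _).1
  have htr : StronglyMeasurable[MeasurableSpace.comap unannotated inferInstance]
      (transformed g : Data E 𝓧 𝓤 𝓥 → ℝ) := by
    refine Measurable.stronglyMeasurable fun s hs => ⟨(fun z => g z.1.2.2 z.2) ⁻¹' s, ?_, rfl⟩
    have : (fun z : (𝓧 × 𝓤 × E) × 𝓥 => g z.1.2.2 z.2)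
        = fun z => Function.uncurry g (z.1.2.2, z.2) := rfl
    rw [this]
    exact (hg.comp (by fun_prop)) hs
  have hres : StronglyMeasurable[MeasurableSpace.comap unannotated inferInstance]
      fun w => transformed g w - imputation g P w := htr.sub (hIs.mono comap_features_le)
  have hresL : MemLp (fun w => transformed g w - imputation g P w) 2 Q := hQ.memLp.sub hI
  have hGm := (hinv.mono comap_features_le).mul hres
  have hGL : MemLp (fun w => (π (covX w))⁻¹ * (transformed g w - imputation g P w)) 2 Q := by
    refine hresL.of_le_mul (c := η⁻¹) (hinvm.aestronglyMeasurable.mul hresL.1)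
      (ae_of_all _ fun w => ?_)
    rw [norm_mul]
    exact mul_le_mul_of_nonneg_right (hinvb w) (norm_nonneg _)
  have hFs : StronglyMeasurable[MeasurableSpace.comap unannotated inferInstance]
      (fullDataScore g π P) :=
    ((hIs.mono comap_features_le).sub stronglyMeasurable_const).add hGm
  have hFL : MemLp (fullDataScore g π P) 2 Q := (hI.sub (memLp_const _)).add hGL
  have hA : MemLp (aipw g π P) 2 P := hP.memLp_aipw hπ hη hπ_mem
  have hAm : Measurable (aipw g π P) :=
    (hIm.add ((measurable_annot_div_and_abs_le hπ hη hπ_mem).1.mul (hm.sub hIm))).sub_const _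
  have hAQ : MemLp (aipw g π P ∘ observe) 2 Q :=
    (memLp_map_measure_iff hAm.aestronglyMeasurable hobs.aemeasurable).1 hA
  refine ⟨⟨hFs, hFL⟩, ?_⟩
  refine ae_eq_condExp_of_forall_setIntegral_eq hobs.comap_le (hFL.integrable (by norm_num))
    (fun _ _ _ => (hAQ.integrable (by norm_num)).integrableOn) ?_
    (hAm.comp (comap_measurable observe)).aestronglyMeasurable
  rintro _ ⟨S, hS, rfl⟩ -
  have hS' := hobs hS
  rw [eq_comm, ← sub_eq_zero, ← integral_sub (hFL.integrable (by norm_num)).integrableOn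
    (hAQ.integrable (by norm_num)).integrableOn, ← integral_indicator hS']
  -- The trace of the observed-data event `S` on unannotated records.
  set T : Set (Data E 𝓧 𝓤 𝓥) := {w | ((0 : E), false, features w) ∈ S} with hT
  have hTs : MeasurableSet[MeasurableSpace.comap features inferInstance] T :=
    ⟨(fun z => ((0 : E), false, z)) ⁻¹' S,
      (by fun_prop : Measurable fun z : 𝓧 × 𝓤 × 𝓥 => ((0 : E), false, z)) hS, rfl⟩
  have hTs' := measurable_features.comap_le _ hTs
  set G : Data E 𝓧 𝓤 𝓥 → ℝ :=
    fun w => (π (covX w))⁻¹ * (transformed g w - imputation g P w) with hG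
  have hpt : ∀ w, (observe ⁻¹' S).indicator
      (fun w => fullDataScore g π P w - (aipw g π P ∘ observe) w) w
        = T.indicator G w - T.indicator G w * annot w := by
    intro w
    have e := fullDataScore_sub_aipw_observe (π := π) hg_hom P w
    by_cases h : annotated w = true
    · have ha : annot w = 1 := by simp [annot, h]
      rw [ha] at e ⊢
      rw [mul_one, sub_self]
      refine Set.indicator_apply_eq_zero.2 fun _ => ?_
      rw [Function.comp_apply, e, mul_one, sub_self]
    · have ha : annot w = 0 := by simp [annot, h]
      rw [ha] at e ⊢
      have hST : w ∈ observe ⁻¹' S ↔ w ∈ T := by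
        rw [Set.mem_preimage, observe_of_not_annotated h]; rfl
      by_cases hw : w ∈ T
      · rw [Set.indicator_of_mem (hST.2 hw), Set.indicator_of_mem hw, Function.comp_apply, e]
      · rw [Set.indicator_of_notMem (fun hh => hw (hST.1 hh)), Set.indicator_of_notMem hw]
        simp
  simp_rw [hpt]
  have hTGm : StronglyMeasurable[MeasurableSpace.comap unannotated inferInstance]
      (T.indicator G) := hGm.indicator (comap_features_le _ hTs)
  have hTGi : Integrable (T.indicator G) Q := (hGL.integrable (by norm_num)).indicator hTs'
  have hTGa : Integrable (fun w => T.indicator G w * annot w) Q :=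
    hTGi.mul_bdd measurable_annot.aestronglyMeasurable
      (ae_of_all _ fun w => (by simpa using abs_annot_le w : ‖annot w‖ ≤ 1))
  rw [integral_sub hTGi hTGa]
  have hweight := integral_div_mul_of_condExp_eq measurable_unannotated.comap_le
    (integrable_annot Q) abs_annot_le hQ.condExp_annot (hπs.mono comap_features_le) hη
    (fun w => (hπ_mem (covX w)).1) hTGm hTGi
  -- Weighting only the first integral by `A / π` puts everything on annotated records: the
  -- integrand becomes `A F (g(M*, V) - μ̃)` with `F = (1 / π)(1 / π - 1)` on `T`, a bounded
  -- function of the features.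
  rw [← hweight, ← integral_sub]
  · set F : Data E 𝓧 𝓤 𝓥 → ℝ :=
      T.indicator fun w => (π (covX w))⁻¹ * ((π (covX w))⁻¹ - 1) with hF
    have hFm : StronglyMeasurable[MeasurableSpace.comap features inferInstance] F :=
      (hinv.mul (hinv.sub stronglyMeasurable_const)).indicator hTs
    have hFP : MemLp F 2 P := by
      refine MemLp.of_bound (hFm.mono measurable_features.comap_le).aestronglyMeasurable
        (η⁻¹ * (η⁻¹ + 1)) (ae_of_all _ fun w => ?_)
      refine (norm_indicator_le_norm_self _ _).trans ?_
      rw [norm_mul]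
      refine mul_le_mul (hinvb w) ((norm_sub_le _ _).trans ?_) (norm_nonneg _)
        (inv_nonneg.2 hη.le)
      rw [norm_one]
      linarith [hinvb w]
    have hzero := integral_annot_mul_residual hP.memLp hFm hFP
    have hFm' : Measurable F := hFm.measurable.mono measurable_features.comap_le le_rfl
    rw [hPdef, integral_map (f := fun w => annot w * (F w * (transformed g w - imputation g P w)))
      hobs.aemeasurable (measurable_annot.mul (hFm'.mul (hm.sub hIm))).aestronglyMeasurable] at hzero
    refine Eq.trans ?_ hzero
    congr 1; ext w
    have h1 := apply_observe_of_features hIs w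
    have h2 : annot (observe w) = annot w := rfl
    have h3 := apply_observe_of_features hFm w
    rw [h1, h2, h3, transformed_observe hg_hom]
    by_cases h : annotated w = true
    · by_cases hw : w ∈ T
      · simp only [annot, h, if_true, hF, Set.indicator_of_mem hw, hG]
        ring
      · simp [hF, Set.indicator_of_notMem hw]
    · simp [annot, h]
  · obtain ⟨h1, h2⟩ := measurable_annot_div_and_abs_le (E := E) (𝓤 := 𝓤) (𝓥 := 𝓥) hπ hη hπ_mem
    exact hTGi.mul_bdd h1.aestronglyMeasurable (ae_of_all _ h2)
  · exact hTGa

theorem aipw_mem_tangentSpace {P : Measure (Data E 𝓧 𝓤 𝓥)} (hg : Measurable (Function.uncurry g))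
    (hg_hom : ∀ c : ℝ, 0 < c → ∀ m v, g (c • m) v = c * g m v) (hπ : Measurable π) (hη : 0 < η)
    (hπ_mem : ∀ x, π x ∈ Set.Icc η 1) (hP : P ∈ model 𝓜 g π) (hA : MemLp (aipw g π P) 2 P) :
    hA.toLp (aipw g π P) ∈ tangentSpace P (paths 𝓜 g π P) := by
  have hP' := isObservedLaw_of_mem_model hg hg_hom hπ hη hπ_mem hP
  obtain ⟨Q, hQp, hQ, rfl⟩ := hP
  have := hP'.prob
  have hobs : Measurable (observe : Data E 𝓧 𝓤 𝓥 → _) := measurable_observe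
  obtain ⟨⟨hFs, hFL⟩, hFe⟩ := condExp_fullDataScore hQ hg hg_hom hπ hη hπ_mem
  set P := Q.map observe with hPdef
  have hmean : ∫ w, fullDataScore g π P w ∂Q = 0 := by
    rw [← integral_condExp hobs.comap_le, ← integral_congr_ae hFe,
      ← hP'.integral_aipw hπ hη hπ_mem, hPdef, integral_map hobs.aemeasurable hA.1]
    rfl
  obtain ⟨f, hf, hfe⟩ := hFs.measurable.exists_eq_measurable_comp
  have hun : AEMeasurable (unannotated : Data E 𝓧 𝓤 𝓥 → _) Q := measurable_unannotated.aemeasurable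
  have hfL : MemLp f 2 (Q.map unannotated) := by
    rw [memLp_map_measure_iff hf.aestronglyMeasurable hun, ← hfe]; exact hFL
  -- Linear combinations are not needed: single scores already approximate the AIPW function.
  refine (closure_mono Submodule.subset_span : closure (tangentSet P (paths 𝓜 g π P)) ⊆ _) ?_
  rw [EMetric.mem_closure_iff]
  intro ε hε
  obtain ⟨s, hs, hsL⟩ := hfL.exists_simpleFunc_eLpNorm_sub_lt (by norm_num)
    (ENNReal.half_pos hε.ne').ne'
  obtain ⟨B, hB⟩ := s.exists_forall_norm_le
  have hSm : StronglyMeasurable[MeasurableSpace.comap unannotated inferInstance]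
      (s ∘ (unannotated : Data E 𝓧 𝓤 𝓥 → _)) :=
    (s.measurable.comp (comap_measurable _)).stronglyMeasurable
  have hSL : MemLp (s ∘ unannotated) 2 Q :=
    (memLp_map_measure_iff s.aestronglyMeasurable hun).1 hsL
  set c := ∫ w, s (unannotated w) ∂Q with hc
  have hSi : Integrable (fun w => s (unannotated w)) Q := hSL.integrable (by norm_num)
  set H : Data E 𝓧 𝓤 𝓥 → ℝ := fun w => s (unannotated w) - c with hH
  obtain ⟨k, hke, γ, hγ, hsc⟩ := exists_path_of_bounded hQ hg hg_hom hπ hη hπ_mem (H := H)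
    (hSm.sub stronglyMeasurable_const) (B := |B| + |c|) (by positivity)
    (fun w => (abs_sub _ _).trans (add_le_add_left ((hB _).trans (le_abs_self B)) _))
    (by rw [integral_sub hSi (integrable_const _)]; simp [hc])
  have hfin : ∀ᶠ t in 𝓝[>] (0 : ℝ), IsFiniteMeasure (γ t) := by
    obtain ⟨C, -, hev⟩ := eventually_of_mem_paths hγ
    filter_upwards [hev] with t ht
    have := (isObservedLaw_of_mem_model hg hg_hom hπ hη hπ_mem ht.1).prob
    infer_instance
  refine ⟨hsc.1.toLp k, ⟨γ, hγ, hsc.congr hfin hsc.1.coeFn_toLp.symm⟩, ?_⟩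
  rw [Lp.edist_toLp_toLp, eLpNorm_map_measure (hA.1.sub hsc.1.1) hobs.aemeasurable]
  have hFi : Integrable (fullDataScore g π P) Q := hFL.integrable (by norm_num)
  have hHi : Integrable H Q := hSi.sub (integrable_const c)
  have e1 : (aipw g π P - k) ∘ observe =ᵐ[Q]
      Q[fullDataScore g π P - H | MeasurableSpace.comap observe inferInstance] := by
    filter_upwards [hFe, hke, condExp_sub hFi hHi (MeasurableSpace.comap observe inferInstance)]
      with w h1 h2 h3
    rw [h3, Pi.sub_apply, ← h1, ← h2]
    rfl
  set D : Data E 𝓧 𝓤 𝓥 → ℝ := fullDataScore g π P - s ∘ unannotated with hD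
  -- The full-data score has mean zero, so centring `s` amounts to centring the error `D`. The mean,
  -- as a conditional expectation given the trivial σ-algebra, is no larger in norm than `D`; this
  -- explains the two halves of `ε`.
  have e2 : fullDataScore g π P - H = D - Q[D | ⊥] := by
    have hint : ∫ w, D w ∂Q = -c := by
      rw [hD, integral_sub' (g := s ∘ unannotated) hFi hSi, hmean, zero_sub]; rfl
    rw [condExp_bot, hint]
    ext w
    simp only [hD, hH, Pi.sub_apply, Function.comp_apply]
    ring
  have hDlt : eLpNorm D 2 Q < ε / 2 := by
    have e3 : D = (f - ⇑s) ∘ unannotated := by rw [hD, hfe]; rfl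
    rw [e3, ← eLpNorm_map_measure (hfL.1.sub s.aestronglyMeasurable) hun]
    exact hs
  have hDm : AEStronglyMeasurable D Q := hFL.1.sub hSL.1
  calc eLpNorm ((aipw g π P - k) ∘ observe) 2 Q
      = eLpNorm (Q[fullDataScore g π P - H | MeasurableSpace.comap observe inferInstance]) 2 Q :=
        eLpNorm_congr_ae e1
    _ ≤ eLpNorm (fullDataScore g π P - H) 2 Q := eLpNorm_condExp_le_eLpNorm _ (by norm_num)
    _ ≤ eLpNorm D 2 Q + eLpNorm (Q[D | ⊥]) 2 Q := by
        rw [e2]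
        exact eLpNorm_sub_le hDm integrable_condExp.1 (by norm_num)
    _ ≤ eLpNorm D 2 Q + eLpNorm D 2 Q := by
        gcongr
        exact eLpNorm_condExp_le_eLpNorm _ (by norm_num)
    _ < ε / 2 + ε / 2 := ENNReal.add_lt_add hDlt hDlt
    _ = ε := ENNReal.add_halves ε

end MARS

end

theorem mainTheorem2 {E 𝓧 𝓤 𝓥 : Type*} [AddCommGroup E] [Module ℝ E]
    [MeasurableSpace E] [StandardBorelSpace E] [MeasurableSpace 𝓧] [StandardBorelSpace 𝓧]
    [MeasurableSpace 𝓤] [StandardBorelSpace 𝓤] [MeasurableSpace 𝓥] [StandardBorelSpace 𝓥]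
    (𝓜 : Set E) (g : E → 𝓥 → ℝ) (hg : Measurable (Function.uncurry g))
    (hg_hom : ∀ c : ℝ, 0 < c → ∀ m v, g (c • m) v = c * g m v)
    (π : 𝓧 → ℝ) (hπ : Measurable π) (η : ℝ) (hη : 0 < η) (hπ_mem : ∀ x, π x ∈ Set.Icc η 1)
    (P : Measure (MARS.Data E 𝓧 𝓤 𝓥)) (hP : P ∈ MARS.model 𝓜 g π)
    (φ : MARS.Data E 𝓧 𝓤 𝓥 → ℝ) :
    Semiparametric.IsEfficientInfluenceFunction P (MARS.paths 𝓜 g π P) (MARS.meanFunctional g) φ ↔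
      φ =ᵐ[P] MARS.aipw g π P := by
  have hI := MARS.isInfluenceFunction_aipw hg hg_hom hπ hη hπ_mem hP
  exact Semiparametric.isEfficientInfluenceFunction_iff_ae_eq
    ⟨hI, hI.1, MARS.aipw_mem_tangentSpace hg hg_hom hπ hη hπ_mem hP hI.1⟩ φ
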